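/- A one-qubit gate is an arbitrary unitary $u\in U(2)$ applied to one qubit, and $CZ$ is the two-qubit gate $\mathrm{diag}(1,1,1,-1)$, which may be applied to any two distinct qubits. A $CZ$-circuit on $N$ qubits is a finite sequence of one-qubit gates and $CZ$ gates on these qubits. For a unitary operator $U$ on $n$ qubits let $|U|_{CZ}$ be the minimum number of $CZ$ gates in an $n$-qubit $CZ$-circuit that computes $U$ exactly, and let $|U|^a_{CZ}=\min_{t\ge 0}|U\otimes I_2^{\otimes t}|_{CZ}$ be the cost when $t$ additional qubits (ancillae) are allowed. (1) For every two-qubit unitary operator $V$, $|V|^a_{CZ}=|V|_{CZ}$. (2) For every two-qubit unitary operator $V$, $|V|_{CZ}\le 3$. (3) Let $n\ge 1$ and let $A$ be a unitary operator on $n$ qubits. Consider the $CZ$-circuits that compute $A\otimes I_2^{\otimes t}$ for some $t\ge 0$ and contain exactly $|A|^a_{CZ}$ $CZ$ gates, and let $\mathcal C$ be one of them whose number $t$ of ancillae is minimal. Then every ancilla qubit in $\mathcal C$ is touched by at least three $CZ$ gates of $\mathcal C$. -/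

import Mathlib

open scoped Kronecker

/-- Operators on a register whose qubits are labelled by `Q`. The computational basis consists of
the bit assignments `Q → Fin 2`. -/
abbrev QOp (Q : Type) [Fintype Q] : Type := Matrix (Q → Fin 2) (Q → Fin 2) ℂ

/-- The operator on the whole register that applies the one-qubit operator `u` to qubit `q` and the
identity to every other qubit. -/
def onQubit {Q : Type} [Fintype Q] [DecidableEq Q] (q : Q) (u : Matrix (Fin 2) (Fin 2) ℂ) :
    QOp Q :=
  Matrix.of fun x y => if ∀ j, j ≠ q → x j = y j then u (x q) (y q) else 0

/-- The controlled-`Z` operator on qubits `i` and `j`: a basis vector gets the sign `-1` exactly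
when both bits are `1`. -/
def controlledZ {Q : Type} [Fintype Q] [DecidableEq Q] (i j : Q) : QOp Q :=
  Matrix.diagonal fun x => if x i = 1 ∧ x j = 1 then -1 else 1

/-- The gates of a CZ-circuit: arbitrary (unitary) one-qubit gates, and CZ gates on two distinct
qubits. -/
inductive CZGate (Q : Type) : Type
  | single (q : Q) (u : Matrix.unitaryGroup (Fin 2) ℂ) : CZGate Q
  | cz (i j : Q) (hij : i ≠ j) : CZGate Q

/-- The operator implemented by a gate. -/
def CZGate.op {Q : Type} [Fintype Q] [DecidableEq Q] : CZGate Q → QOp Q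
  | .single q u => onQubit q (u : Matrix (Fin 2) (Fin 2) ℂ)
  | .cz i j _ => controlledZ i j

/-- The number of CZ gates (0 or 1) that a gate contributes. -/
def CZGate.czCount {Q : Type} : CZGate Q → ℕ
  | .single _ _ => 0
  | .cz _ _ _ => 1

/-- The number of CZ gates touching qubit `q` (0 or 1) that a gate contributes. -/
def CZGate.czTouching {Q : Type} [DecidableEq Q] (q : Q) : CZGate Q → ℕ
  | .single _ _ => 0
  | .cz i j _ => if q = i ∨ q = j then 1 else 0

/-- A CZ-circuit is a finite sequence of gates, the leftmost one acting last. -/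
abbrev CZCircuit (Q : Type) : Type := List (CZGate Q)

/-- The operator computed by a CZ-circuit. -/
def CZCircuit.op {Q : Type} [Fintype Q] [DecidableEq Q] (C : CZCircuit Q) : QOp Q :=
  (C.map CZGate.op).prod

/-- The number of CZ gates in a circuit. -/
def CZCircuit.czCount {Q : Type} (C : CZCircuit Q) : ℕ :=
  (C.map CZGate.czCount).sum

/-- The number of CZ gates in a circuit that touch qubit `q`. -/
def CZCircuit.czTouching {Q : Type} [DecidableEq Q] (C : CZCircuit Q) (q : Q) : ℕ :=
  (C.map (CZGate.czTouching q)).sum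

/-- The CZ-cost of an operator: the minimum number of CZ gates in a CZ-circuit on the same qubits
that computes it (`⊤` if there is no such circuit). -/
noncomputable def czCost {Q : Type} [Fintype Q] [DecidableEq Q] (U : QOp Q) : ℕ∞ :=
  ⨅ (C : CZCircuit Q) (_ : CZCircuit.op C = U), (CZCircuit.czCount C : ℕ∞)

/-- The operator `U ⊗ I` on the qubits of `U` (left summand) and `t` ancillae (right summand). -/
def withAncillae {Q : Type} [Fintype Q] [DecidableEq Q] (U : QOp Q) (t : ℕ) : QOp (Q ⊕ Fin t) :=
  (U ⊗ₖ (1 : QOp (Fin t))).submatrix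
    (Equiv.sumArrowEquivProdArrow Q (Fin t) (Fin 2)) (Equiv.sumArrowEquivProdArrow Q (Fin t) (Fin 2))

/-- The CZ-cost with ancillae: the minimum over `t` of the CZ-cost of `U ⊗ I` with `t` ancillae. -/
noncomputable def czCostAncilla {Q : Type} [Fintype Q] [DecidableEq Q] (U : QOp Q) : ℕ∞ :=
  ⨅ t : ℕ, czCost (withAncillae U t)

/-- `C` computes `U` with `t` ancillae and uses the least number of CZ gates possible with any
number of ancillae. -/
def IsCZOptimal {Q : Type} [Fintype Q] [DecidableEq Q] (U : QOp Q) (t : ℕ)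
    (C : CZCircuit (Q ⊕ Fin t)) : Prop :=
  CZCircuit.op C = withAncillae U t ∧ (CZCircuit.czCount C : ℕ∞) = czCostAncilla U

/-- `C` is qubit-minimal among the circuits that compute `U`, possibly with ancillae, and use the
least possible number of CZ gates. -/
def IsQubitMinimalCZOptimal {Q : Type} [Fintype Q] [DecidableEq Q] (U : QOp Q) (t : ℕ)
    (C : CZCircuit (Q ⊕ Fin t)) : Prop :=
  IsCZOptimal U t C ∧ ∀ (s : ℕ) (D : CZCircuit (Q ⊕ Fin s)), IsCZOptimal U s D → t ≤ s

/-! Ancillae are removed by projection. If an ancilla is touched by at most two CZ gates, then in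
the main case the circuit has the form (u ⊗ D₁) CZ (v ⊗ D₃) CZ (w ⊗ D₄) = 1 ⊗ B. Cancel the outer
factors and sandwich the rest between |i⟩⟨i| and |j⟩⟨j| on the ancilla, where v i j ≠ 0. Each CZ
gate becomes a power of Z on its other qubit, so B is a scalar multiple of D₁ Z^i D₃ Z^j D₄. By
unitarity the scalar is a phase, which a one-qubit gate absorbs. Thus the ancilla disappears without
new CZ gates, against qubit-minimality (`exists_circuit_without_none`,
`three_le_czTouching_of_isQubitMinimalCZOptimal`).

Hence ancillae cannot help an operator of cost at most three: a qubit-minimal optimal circuit that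
still has an ancilla contains three CZ gates already (`czCostAncilla_eq_czCost_of_le_three`).

The bound three for two qubits is the canonical (KAK) decomposition. In the magic basis a two-qubit
unitary becomes a matrix K D Pᵀ with K, P real orthogonal and D diagonal
(`exists_orthogonal_diagonal_orthogonal`). The magic basis consists of the quaternion units, and the
isometries of the quaternions are x ↦ a x b and x ↦ a x* b; so K and P are local gates up to signs,
which D absorbs (`exists_magic_mul_orthogonal`). An explicit circuit with three CNOT gates realizes
every D (`circuit_mul_magic`, `isComputable_magic_diagonal`). -/

set_option linter.unusedSectionVars false

/-! ### Circuits, costs and relabelling of qubits. -/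

section Register

variable {Q Q' : Type} [Fintype Q] [DecidableEq Q] [Fintype Q'] [DecidableEq Q']

theorem onQubit_one (q : Q) : onQubit q 1 = 1 := by
  ext x y
  by_cases h : x = y
  · subst h; simp [onQubit]
  · rw [Matrix.one_apply_ne h]
    simp only [onQubit, Matrix.of_apply, ite_eq_right_iff]
    intro h'
    apply Matrix.one_apply_ne
    intro h2
    apply h
    funext j
    by_cases hj : j = q
    · rw [hj, h2]
    · exact h' j hj

theorem onQubit_mul (q : Q) (u v : Matrix (Fin 2) (Fin 2) ℂ) :
    onQubit q u * onQubit q v = onQubit q (u * v) := by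
  ext x y
  rw [Matrix.mul_apply]
  have hinj : Function.Injective fun b : Fin 2 => Function.update x q b := by
    intro b c h
    simpa using congrFun h q
  rw [← Finset.sum_subset (Finset.subset_univ (Finset.univ.map ⟨_, hinj⟩))]
  · rw [Finset.sum_map]
    simp only [onQubit, Matrix.of_apply, Function.Embedding.coeFn_mk]
    by_cases h : ∀ j, j ≠ q → x j = y j
    · rw [if_pos h, Matrix.mul_apply]
      refine Finset.sum_congr rfl fun b _ => ?_
      rw [if_pos (fun j hj => by simp [hj]), if_pos (fun j hj => by simp [hj, h j hj])]
      simp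
    · rw [if_neg h]
      refine Finset.sum_eq_zero fun b _ => ?_
      rw [if_neg (c := ∀ j, j ≠ q → Function.update x q b j = y j), mul_zero]
      intro h'
      exact h fun j hj => by simpa [hj] using h' j hj
  · intro z _ hz
    simp only [onQubit, Matrix.of_apply]
    rw [if_neg, zero_mul]
    intro h
    apply hz
    simp only [Finset.mem_map, Finset.mem_univ, true_and, Function.Embedding.coeFn_mk]
    refine ⟨z q, funext fun j => ?_⟩
    by_cases hj : j = q
    · subst hj; simp
    · simp [hj, h j hj]

theorem onQubit_conjTranspose (q : Q) (u : Matrix (Fin 2) (Fin 2) ℂ) :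
    (onQubit q u).conjTranspose = onQubit q u.conjTranspose := by
  ext x y
  simp only [onQubit, Matrix.conjTranspose_apply, Matrix.of_apply, eq_comm (a := x _)]
  split_ifs <;> simp

theorem onQubit_smul_one (q : Q) (c : ℂ) : onQubit q (c • 1) = c • (1 : QOp Q) := by
  rw [← onQubit_one q]
  ext x y
  simp [onQubit]

theorem CZGate.op_mem_unitaryGroup (g : CZGate Q) :
    g.op ∈ Matrix.unitaryGroup (Q → Fin 2) ℂ := by
  rw [Matrix.mem_unitaryGroup_iff]
  cases g with
  | single q u =>
    rw [CZGate.op, Matrix.star_eq_conjTranspose, onQubit_conjTranspose, onQubit_mul,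
      ← Matrix.star_eq_conjTranspose, Matrix.mem_unitaryGroup_iff.1 u.2, onQubit_one]
  | cz i j h =>
    rw [CZGate.op, controlledZ, Matrix.star_eq_conjTranspose, Matrix.diagonal_conjTranspose,
      Matrix.diagonal_mul_diagonal, ← Matrix.diagonal_one]
    congr 1
    funext x
    simp only [Pi.star_apply]
    split_ifs <;> simp

theorem CZCircuit.op_mem_unitaryGroup (C : CZCircuit Q) :
    C.op ∈ Matrix.unitaryGroup (Q → Fin 2) ℂ := by
  refine Submonoid.list_prod_mem _ fun M hM => ?_
  obtain ⟨g, -, rfl⟩ := List.mem_map.1 hM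
  exact g.op_mem_unitaryGroup

@[simp] theorem CZCircuit.op_nil : CZCircuit.op ([] : CZCircuit Q) = 1 := rfl

@[simp] theorem CZCircuit.op_cons (g : CZGate Q) (C : CZCircuit Q) :
    CZCircuit.op (g :: C) = g.op * CZCircuit.op C := by simp [CZCircuit.op]

@[simp] theorem CZCircuit.op_append (C D : CZCircuit Q) :
    CZCircuit.op (C ++ D) = CZCircuit.op C * CZCircuit.op D := by simp [CZCircuit.op]

@[simp] theorem CZCircuit.czCount_nil : CZCircuit.czCount ([] : CZCircuit Q) = 0 := rfl

@[simp] theorem CZCircuit.czCount_cons (g : CZGate Q) (C : CZCircuit Q) :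
    CZCircuit.czCount (g :: C) = g.czCount + CZCircuit.czCount C := by simp [CZCircuit.czCount]

@[simp] theorem CZCircuit.czCount_append (C D : CZCircuit Q) :
    CZCircuit.czCount (C ++ D) = CZCircuit.czCount C + CZCircuit.czCount D := by
  simp [CZCircuit.czCount]

theorem CZCircuit.czTouching_le_czCount (C : CZCircuit Q) (q : Q) :
    C.czTouching q ≤ C.czCount := by
  refine List.sum_le_sum fun g _ => ?_
  cases g <;> simp only [CZGate.czTouching, CZGate.czCount]
  · rfl
  · split_ifs <;> simp

theorem czCost_le_czCount {U : QOp Q} (C : CZCircuit Q) (h : C.op = U) :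
    czCost U ≤ (C.czCount : ℕ∞) := iInf₂_le C h

theorem exists_czCount_eq_czCost {U : QOp Q} (h : czCost U ≠ ⊤) :
    ∃ C : CZCircuit Q, C.op = U ∧ (C.czCount : ℕ∞) = czCost U := by
  have hne : Nonempty {C : CZCircuit Q // C.op = U} := by
    by_contra hn
    refine h (iInf₂_eq_top.2 fun C hC => (hn ⟨C, hC⟩).elim)
  obtain ⟨⟨C, hC⟩, hmin⟩ := ciInf_mem fun C : {C : CZCircuit Q // C.op = U} => (C.1.czCount : ℕ∞)
  exact ⟨C, hC, by rw [czCost, iInf_subtype']; exact hmin⟩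

/-- Relabelling the qubits of an operator. -/
def relabel (e : Q ≃ Q') (M : QOp Q) : QOp Q' :=
  M.submatrix (e.arrowCongr (Equiv.refl (Fin 2))).symm (e.arrowCongr (Equiv.refl (Fin 2))).symm

theorem relabel_apply (e : Q ≃ Q') (M : QOp Q) (x y : Q' → Fin 2) :
    relabel e M x y = M (fun q => x (e q)) (fun q => y (e q)) := rfl

theorem relabel_one (e : Q ≃ Q') : relabel e (1 : QOp Q) = 1 := Matrix.submatrix_one_equiv _

theorem relabel_mul (e : Q ≃ Q') (M N : QOp Q) :
    relabel e (M * N) = relabel e M * relabel e N := (Matrix.submatrix_mul_equiv _ _ _ _ _).symm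

/-- Relabelling the qubits of a gate. -/
def CZGate.relabel {Q Q' : Type} (e : Q ≃ Q') : CZGate Q → CZGate Q'
  | .single q u => .single (e q) u
  | .cz i j h => .cz (e i) (e j) (e.injective.ne h)

theorem CZGate.op_relabel (e : Q ≃ Q') (g : CZGate Q) :
    (g.relabel e).op = _root_.relabel e g.op := by
  ext x y
  cases g with
  | single q u =>
    simp only [CZGate.relabel, CZGate.op, relabel_apply, onQubit, Matrix.of_apply]
    congr 1
    refine propext ⟨fun h j hj => h _ (e.injective.ne hj), fun h j hj => ?_⟩
    simpa using h (e.symm j) fun h' => hj (by simp [← h'])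
  | cz i j h =>
    simp only [CZGate.relabel, CZGate.op, relabel_apply, controlledZ, Matrix.diagonal_apply]
    congr 1
    refine propext ⟨fun h => by rw [h], fun h => funext fun j => ?_⟩
    simpa using congrFun h (e.symm j)

theorem CZCircuit.op_relabel (e : Q ≃ Q') (C : CZCircuit Q) :
    CZCircuit.op (C.map (CZGate.relabel e)) = relabel e C.op := by
  induction C with
  | nil => exact (relabel_one e).symm
  | cons g C ih =>
    rw [List.map_cons, CZCircuit.op_cons, CZCircuit.op_cons, relabel_mul, ih, CZGate.op_relabel]

theorem CZCircuit.czCount_relabel (e : Q ≃ Q') (C : CZCircuit Q) :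
    CZCircuit.czCount (C.map (CZGate.relabel e)) = C.czCount := by
  rw [CZCircuit.czCount, CZCircuit.czCount, List.map_map]
  congr 1
  refine List.map_congr_left fun g _ => ?_
  cases g <;> rfl

theorem CZCircuit.czTouching_relabel (e : Q ≃ Q') (C : CZCircuit Q) (q : Q) :
    CZCircuit.czTouching (C.map (CZGate.relabel e)) (e q) = C.czTouching q := by
  rw [CZCircuit.czTouching, CZCircuit.czTouching, List.map_map]
  congr 1
  refine List.map_congr_left fun g _ => ?_
  cases g <;> simp [CZGate.relabel, CZGate.czTouching]

/-- Relabelling qubits does not increase the cost. -/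
theorem czCost_relabel_le (e : Q ≃ Q') (U : QOp Q) : czCost (relabel e U) ≤ czCost U := by
  refine le_iInf₂ fun C hC => ?_
  rw [← CZCircuit.czCount_relabel e C]
  exact czCost_le_czCount _ (by rw [CZCircuit.op_relabel, hC])

theorem withAncillae_apply (U : QOp Q) (t : ℕ) (x y : Q ⊕ Fin t → Fin 2) :
    withAncillae U t x y = U (fun q => x (.inl q)) (fun q => y (.inl q)) *
      (1 : QOp (Fin t)) (fun q => x (.inr q)) (fun q => y (.inr q)) := rfl

theorem withAncillae_zero (U : QOp Q) :
    withAncillae U 0 = relabel (Equiv.sumEmpty Q (Fin 0)).symm U := by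
  ext x y
  rw [withAncillae_apply, relabel_apply, Subsingleton.elim (fun q : Fin 0 => x (.inr q))
    (fun q => y (.inr q)), Matrix.one_apply_eq, mul_one]
  rfl

theorem relabel_withAncillae_zero (U : QOp Q) :
    relabel (Equiv.sumEmpty Q (Fin 0)) (withAncillae U 0) = U := by
  rw [withAncillae_zero]
  ext x y
  simp [relabel_apply]

theorem czCost_withAncillae_zero (U : QOp Q) : czCost (withAncillae U 0) = czCost U := by
  apply le_antisymm
  · rw [withAncillae_zero]
    exact czCost_relabel_le _ _
  · conv_lhs => rw [← relabel_withAncillae_zero U]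
    exact czCost_relabel_le _ _

theorem czCostAncilla_le_czCost (U : QOp Q) : czCostAncilla U ≤ czCost U :=
  (iInf_le _ 0).trans_eq (czCost_withAncillae_zero U)

/-! ### Splitting off one qubit and projecting it. -/

/-- The tensor product of a one-qubit operator on the qubit `none` with an operator on the other
qubits. -/
def optionTensor (u : Matrix (Fin 2) (Fin 2) ℂ) (M : QOp Q) : QOp (Option Q) :=
  (u ⊗ₖ M).submatrix (Equiv.piOptionEquivProd (β := fun _ : Option Q => Fin 2))
    (Equiv.piOptionEquivProd (β := fun _ : Option Q => Fin 2))

theorem optionTensor_apply (u : Matrix (Fin 2) (Fin 2) ℂ) (M : QOp Q) (x y : Option Q → Fin 2) :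
    optionTensor u M x y =
      u (x none) (y none) * M (fun q => x (some q)) (fun q => y (some q)) := rfl

theorem optionTensor_mul (u v : Matrix (Fin 2) (Fin 2) ℂ) (M N : QOp Q) :
    optionTensor u M * optionTensor v N = optionTensor (u * v) (M * N) := by
  rw [optionTensor, optionTensor, Matrix.submatrix_mul_equiv, ← Matrix.mul_kronecker_mul,
    optionTensor]

theorem optionTensor_one : optionTensor 1 (1 : QOp Q) = 1 := by
  rw [optionTensor, Matrix.one_kronecker_one, Matrix.submatrix_one_equiv]

/-- The Pauli operator `Z`. -/
def pauliZ : Matrix.unitaryGroup (Fin 2) ℂ :=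
  ⟨Matrix.diagonal ![1, -1], by
    rw [Matrix.mem_unitaryGroup_iff, Matrix.star_eq_conjTranspose, Matrix.diagonal_conjTranspose,
      Matrix.diagonal_mul_diagonal, ← Matrix.diagonal_one]
    congr 1
    funext i
    fin_cases i <;> simp⟩

/-- The one-qubit circuit for `Z ^ i` on qubit `q`. -/
def pauliZPow (q : Q) (i : Fin 2) : CZCircuit Q := if i = 1 then [.single q pauliZ] else []

theorem op_single_none (u : Matrix.unitaryGroup (Fin 2) ℂ) :
    (CZGate.single (none : Option Q) u).op = optionTensor u 1 := by
  ext x y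
  simp only [CZGate.op, onQubit, Matrix.of_apply, optionTensor_apply, Matrix.one_apply, mul_ite,
    mul_one, mul_zero]
  congr 1
  refine propext ⟨fun h => funext fun q => h _ (by simp), fun h j hj => ?_⟩
  cases j with
  | none => exact (hj rfl).elim
  | some q => exact congrFun h q

theorem op_single_some (q : Q) (u : Matrix.unitaryGroup (Fin 2) ℂ) :
    (CZGate.single (some q) u).op = optionTensor 1 (CZGate.single q u).op := by
  ext x y
  simp only [CZGate.op, onQubit, Matrix.of_apply, optionTensor_apply, Matrix.one_apply]
  by_cases h : x none = y none
  · rw [if_pos h, one_mul]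
    congr 1
    refine propext ⟨fun h' j hj => h' _ (by simpa using hj), fun h' j hj => ?_⟩
    cases j with
    | none => exact h
    | some q => exact h' q (by simpa using hj)
  · rw [if_neg h, zero_mul, if_neg fun h' => h (h' none (by simp))]

theorem eq_iff_none_some (x y : Option Q → Fin 2) :
    x = y ↔ x none = y none ∧ (fun q => x (some q)) = fun q => y (some q) := by
  refine ⟨fun h => by simp [h], fun ⟨h, h'⟩ => funext fun j => ?_⟩
  cases j with
  | none => exact h
  | some q => exact congrFun h' q

theorem op_cz_some (i j : Q) (h : i ≠ j) (h' : some i ≠ some j) :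
    (CZGate.cz (some i) (some j) h').op = optionTensor 1 (CZGate.cz i j h).op := by
  ext x y
  simp only [CZGate.op, controlledZ, Matrix.diagonal_apply, optionTensor_apply, Matrix.one_apply,
    eq_iff_none_some x y]
  split_ifs <;> simp_all

theorem controlledZ_comm (i j : Q) : controlledZ i j = controlledZ j i := by
  simp only [controlledZ, and_comm]

/-- The entries of a `CZ` between `none` and `some q` are those of `1` or of `Z` on `q`, according
to the value of the control. -/
theorem controlledZ_none_apply (q : Q) (x y : Option Q → Fin 2) :
    controlledZ none (some q) x y = if x none = y none then
      CZCircuit.op (pauliZPow q (x none))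
        (fun q => x (some q)) (fun q => y (some q)) else 0 := by
  by_cases h : x none = y none
  · rw [if_pos h]
    by_cases h1 : x none = 1
    · rw [pauliZPow, if_pos h1]
      by_cases hq : (fun q => x (some q)) = fun q => y (some q)
      · have hxy : x = y := (eq_iff_none_some x y).2 ⟨h, hq⟩
        subst hxy
        have : x (some q) = 0 ∨ x (some q) = 1 := by omega
        rcases this with h2 | h2 <;>
          simp [controlledZ, h1, h2, CZGate.op, onQubit, pauliZ]
      · have hxy : x ≠ y := fun h => hq (by simp [h])
        have hq' : ∃ j, x (some j) ≠ y (some j) := by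
          by_contra! h
          exact hq (funext h)
        obtain ⟨j, hj⟩ := hq'
        simp only [controlledZ, Matrix.diagonal_apply_ne _ hxy, CZCircuit.op_cons, CZCircuit.op_nil,
          mul_one, CZGate.op, onQubit, Matrix.of_apply, pauliZ]
        split_ifs with h3
        · have : j = q := by
            by_contra h4
            exact hj (h3 j h4)
          subst this
          rw [Matrix.diagonal_apply_ne _ hj]
        · rfl
    · rw [pauliZPow, if_neg h1]
      simp [controlledZ, Matrix.diagonal_apply, Matrix.one_apply, eq_iff_none_some x y, ← h, h1]
  · rw [if_neg h, controlledZ, Matrix.diagonal_apply_ne]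
    exact fun h' => h (by rw [h'])

/-- Projecting the control onto a basis state fixes its bit, so the CZ gate acts on the other qubit
alone. This is the step that trades a CZ gate for a one-qubit gate. -/
theorem optionTensor_single_mul_controlledZ (i : Fin 2) (q : Q) :
    optionTensor (Matrix.single i i 1) 1 * controlledZ none (some q) =
      optionTensor (Matrix.single i i 1)
        (CZCircuit.op (pauliZPow q i)) := by
  ext x y
  have hK := controlledZ_none_apply q x y
  rw [controlledZ, Matrix.diagonal_apply] at hK
  rw [controlledZ, Matrix.mul_diagonal, optionTensor_apply, optionTensor_apply,
    Matrix.single_apply]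
  by_cases h : i = x none ∧ i = y none
  · rw [if_pos h]
    obtain ⟨hx, hy⟩ := h
    rw [if_pos (hx.symm.trans hy), ← hx] at hK
    rw [one_mul, one_mul, ← hK, Matrix.one_apply]
    by_cases h : (fun q => x (some q)) = fun q => y (some q)
    · rw [if_pos h, if_pos ((eq_iff_none_some x y).2 ⟨hx.symm.trans hy, h⟩), one_mul, ← hy,
        congrFun h q]
    · rw [if_neg h, if_neg fun h' : x = y => h (by rw [h']), zero_mul]
  · rw [if_neg h]
    simp

theorem controlledZ_mul_optionTensor_single (i : Fin 2) (q : Q) :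
    controlledZ none (some q) * optionTensor (Matrix.single i i 1) 1 =
      optionTensor (Matrix.single i i 1)
        (CZCircuit.op (pauliZPow q i)) := by
  rw [← optionTensor_single_mul_controlledZ]
  ext x y
  rw [controlledZ, Matrix.mul_diagonal, Matrix.diagonal_mul, optionTensor_apply]
  by_cases h : x = y
  · rw [h, mul_comm]
  · by_cases hx : (fun q => x (some q)) = fun q => y (some q)
    · have hn : x none ≠ y none := fun hn => h ((eq_iff_none_some x y).2 ⟨hn, hx⟩)
      simp only [Matrix.single_apply]
      rw [if_neg fun h : i = x none ∧ i = y none => hn (h.1.symm.trans h.2)]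
      simp
    · rw [Matrix.one_apply_ne hx]
      simp

/-- Fixing the row and column bits of `none` selects one block of each side. -/
theorem smul_eq_smul_of_optionTensor_eq {a b : Matrix (Fin 2) (Fin 2) ℂ} {M N : QOp Q}
    (h : optionTensor a M = optionTensor b N) (i j : Fin 2) : a i j • M = b i j • N := by
  ext x y
  simpa [optionTensor_apply] using
    congrFun (congrFun h fun o => o.elim i x) fun o => o.elim j y

theorem unitary_ne_zero {ι : Type} [Fintype ι] [DecidableEq ι] [Nonempty ι] {M : Matrix ι ι ℂ}
    (hM : M ∈ Matrix.unitaryGroup ι ℂ) : M ≠ 0 := by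
  rintro rfl
  rw [Matrix.mem_unitaryGroup_iff, zero_mul] at hM
  exact zero_ne_one hM

/-- Gates on `none` commute with all the others and multiply to `u`; the rest form `D`. -/
theorem exists_optionTensor_of_czTouching_eq_zero (C : CZCircuit (Option Q))
    (h : C.czTouching none = 0) :
    ∃ u ∈ Matrix.unitaryGroup (Fin 2) ℂ, ∃ D : CZCircuit Q,
      C.op = optionTensor u D.op ∧ D.czCount = C.czCount := by
  induction C with
  | nil => exact ⟨1, one_mem _, [], by simp [optionTensor_one], rfl⟩
  | cons g C ih =>
    simp only [CZCircuit.czTouching, List.map_cons, List.sum_cons, Nat.add_eq_zero_iff] at h ih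
    obtain ⟨u, hu, D, hD, hcount⟩ := ih h.2
    rw [CZCircuit.op_cons, CZCircuit.czCount_cons, hD, ← hcount]
    cases g with
    | single q v =>
      cases q with
      | none =>
        exact ⟨v * u, mul_mem v.2 hu, D, by rw [op_single_none, optionTensor_mul, one_mul],
          (zero_add _).symm⟩
      | some q =>
        exact ⟨u, hu, .single q v :: D, by
          rw [op_single_some, optionTensor_mul, one_mul, CZCircuit.op_cons], rfl⟩
    | cz i j hij =>
      cases i with
      | none => simp [CZGate.czTouching] at h
      | some i =>
        cases j with
        | none => simp [CZGate.czTouching] at h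
        | some j =>
          have hij' : i ≠ j := fun h => hij (by rw [h])
          exact ⟨u, hu, .cz i j hij' :: D, by
            rw [op_cz_some i j hij', optionTensor_mul, one_mul, CZCircuit.op_cons], by
              rw [CZCircuit.czCount_cons]; rfl⟩

/-- A circuit that touches `none` can be split at the leftmost `CZ` gate touching it. -/
theorem exists_eq_mul_controlledZ_mul (C : CZCircuit (Option Q)) (k : ℕ)
    (h : C.czTouching none = k + 1) :
    ∃ (C₁ C₂ : CZCircuit (Option Q)) (q : Q),
      C.op = C₁.op * controlledZ none (some q) * C₂.op ∧ C₁.czTouching none = 0 ∧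
      C₂.czTouching none = k ∧ C.czCount = C₁.czCount + C₂.czCount + 1 := by
  induction C with
  | nil => simp [CZCircuit.czTouching] at h
  | cons g C ih =>
    by_cases hg : g.czTouching none = 0
    · have h' : CZCircuit.czTouching C none = k + 1 := by
        simpa [CZCircuit.czTouching, hg] using h
      obtain ⟨C₁, C₂, q, hop, h₁, h₂, hcount⟩ := ih h'
      refine ⟨g :: C₁, C₂, q, by simp [hop, Matrix.mul_assoc], ?_, h₂, ?_⟩
      · simpa [CZCircuit.czTouching, hg] using h₁
      · simp only [CZCircuit.czCount_cons, hcount]; omega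
    · cases g with
      | single q v => exact (hg rfl).elim
      | cz i j hij =>
        have h1 : (CZGate.cz i j hij).czTouching none = 1 := by
          simp only [CZGate.czTouching] at hg ⊢
          split_ifs at hg ⊢ <;> simp_all
        have h2 : CZCircuit.czTouching C none = k := by
          simp only [CZCircuit.czTouching, List.map_cons, List.sum_cons, h1] at h ⊢
          omega
        have h3 : ∃ q, controlledZ i j = controlledZ none (some q) := by
          cases i with
          | none =>
            cases j with
            | none => exact (hij rfl).elim
            | some j => exact ⟨j, rfl⟩
          | some i =>
            cases j with
            | none => exact ⟨i, controlledZ_comm _ _⟩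
            | some j => simp [CZGate.czTouching] at hg
        obtain ⟨q, hq⟩ := h3
        refine ⟨[], C, q, by simp [CZGate.op, hq], rfl, h2, ?_⟩
        simp only [CZCircuit.czCount_cons, CZCircuit.czCount_nil, CZGate.czCount]
        omega

theorem exists_apply_ne_zero_of_unitary {u : Matrix (Fin 2) (Fin 2) ℂ}
    (hu : u ∈ Matrix.unitaryGroup (Fin 2) ℂ) : ∃ i j, u i j ≠ 0 := by
  by_contra! h
  exact unitary_ne_zero hu (Matrix.ext h)

/-- The left side of `h` is nonzero, so `b ≠ 0`, and the unitary factors around `B` can be undone.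
-/
theorem eq_smul_of_smul_eq_smul_star {a b : ℂ} {B M N P : QOp Q}
    (hM : M ∈ Matrix.unitaryGroup (Q → Fin 2) ℂ) (hN : N ∈ Matrix.unitaryGroup (Q → Fin 2) ℂ)
    (hP : P ∈ Matrix.unitaryGroup (Q → Fin 2) ℂ) (ha : a ≠ 0)
    (h : a • P = b • (star M * B * star N)) : B = (a / b) • (M * P * N) := by
  have hb : b ≠ 0 := by
    rintro rfl
    rw [zero_smul] at h
    exact (smul_ne_zero ha (unitary_ne_zero hP)) h
  have hB : b • B = a • (M * P * N) := by
    calc b • B = M * (b • (star M * B * star N)) * N := by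
          rw [Matrix.mul_smul, Matrix.smul_mul, ← Matrix.mul_assoc, ← Matrix.mul_assoc,
            Matrix.mem_unitaryGroup_iff.1 hM, Matrix.one_mul, Matrix.mul_assoc B,
            Matrix.mem_unitaryGroup_iff'.1 hN, Matrix.mul_one]
      _ = a • (M * P * N) := by rw [← h, Matrix.mul_smul, Matrix.smul_mul]
  rw [div_eq_inv_mul, mul_smul, ← hB, inv_smul_smul₀ hb]

theorem optionTensor_cancel {u v : Matrix (Fin 2) (Fin 2) ℂ} {B M N : QOp Q} {K : QOp (Option Q)}
    (hu : u ∈ Matrix.unitaryGroup (Fin 2) ℂ) (hv : v ∈ Matrix.unitaryGroup (Fin 2) ℂ)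
    (hM : M ∈ Matrix.unitaryGroup (Q → Fin 2) ℂ) (hN : N ∈ Matrix.unitaryGroup (Q → Fin 2) ℂ)
    (h : optionTensor u M * K * optionTensor v N = optionTensor 1 B) :
    K = optionTensor (star u * star v) (star M * B * star N) := by
  have h' := congrArg (fun X => optionTensor (star u) (star M) * X * optionTensor (star v) (star N)) h
  simp only [optionTensor_mul, Matrix.mul_one, ← Matrix.mul_assoc] at h'
  rw [← h', Matrix.mem_unitaryGroup_iff'.1 hu, Matrix.mem_unitaryGroup_iff'.1 hM, optionTensor_one,
    Matrix.one_mul, Matrix.mul_assoc K, optionTensor_mul, Matrix.mem_unitaryGroup_iff.1 hv,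
    Matrix.mem_unitaryGroup_iff.1 hN, optionTensor_one, Matrix.mul_one]

theorem czCount_pauliZPow (q : Q) (i : Fin 2) : (pauliZPow q i).czCount = 0 := by
  rw [pauliZPow]
  split_ifs <;> rfl

/-- If a circuit leaves the qubit `none` alone and touches it by at most two `CZ` gates, then these
gates can be dropped together with the qubit. -/
theorem exists_circuit_without_none (C : CZCircuit (Option Q)) (B : QOp Q)
    (h : C.czTouching none ≤ 2) (hC : C.op = optionTensor 1 B) :
    ∃ (c : ℂ) (D : CZCircuit Q), B = c • D.op ∧ D.czCount + C.czTouching none = C.czCount := by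
  rcases hk : C.czTouching none with _ | k
  · obtain ⟨u, -, D, hop, hcount⟩ := exists_optionTensor_of_czTouching_eq_zero C hk
    refine ⟨u 0 0, D, ?_, hcount⟩
    have := smul_eq_smul_of_optionTensor_eq (hC.symm.trans hop) 0 0
    simpa using this
  obtain ⟨C₁, C₂, q, hop, h₁, h₂, hcount⟩ := exists_eq_mul_controlledZ_mul C k hk
  obtain ⟨u, hu, D₁, hop₁, hcount₁⟩ := exists_optionTensor_of_czTouching_eq_zero C₁ h₁
  rcases k with _ | k
  · obtain ⟨v, hv, D₂, hop₂, hcount₂⟩ := exists_optionTensor_of_czTouching_eq_zero C₂ h₂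
    rw [hop, hop₁, hop₂] at hC
    have hK := optionTensor_cancel hu hv D₁.op_mem_unitaryGroup D₂.op_mem_unitaryGroup hC
    -- For a single CZ gate the projection |0⟩⟨0| on the left suffices: the (0, 0) block of the
    -- projected gate is the identity.
    have hK' := optionTensor_single_mul_controlledZ 0 q
    rw [hK, optionTensor_mul] at hK'
    have h3 := smul_eq_smul_of_optionTensor_eq hK'.symm 0 0
    rw [Matrix.one_mul] at h3
    have h4 := eq_smul_of_smul_eq_smul_star D₁.op_mem_unitaryGroup D₂.op_mem_unitaryGroup
      (CZCircuit.op_mem_unitaryGroup _) (by simp) h3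
    rw [← CZCircuit.op_append, ← CZCircuit.op_append] at h4
    refine ⟨_, _, h4, ?_⟩
    simp only [CZCircuit.czCount_append, czCount_pauliZPow]
    omega
  · obtain rfl : k = 0 := by omega
    obtain ⟨C₃, C₄, q', hop', h₃, h₄, hcount'⟩ := exists_eq_mul_controlledZ_mul C₂ _ h₂
    obtain ⟨v, hv, D₃, hop₃, hcount₃⟩ := exists_optionTensor_of_czTouching_eq_zero C₃ h₃
    obtain ⟨w, hw, D₄, hop₄, hcount₄⟩ := exists_optionTensor_of_czTouching_eq_zero C₄ h₄
    -- A nonzero entry of the ancilla gate between the two CZ gates tells which projections to use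
    -- on either side, so that the projected equation does not vanish.
    obtain ⟨i, j, hij⟩ := exists_apply_ne_zero_of_unitary hv
    have hC' : optionTensor u D₁.op * (controlledZ none (some q) * optionTensor v D₃.op *
        controlledZ none (some q')) * optionTensor w D₄.op = optionTensor 1 B := by
      rw [← hC, hop, hop', hop₁, hop₃, hop₄]
      simp only [Matrix.mul_assoc]
    have hK := optionTensor_cancel hu hw D₁.op_mem_unitaryGroup D₄.op_mem_unitaryGroup hC'
    have hK' := congrArg (fun X => optionTensor (Matrix.single i i 1) 1 * X *
      optionTensor (Matrix.single j j 1) 1) hK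
    simp only [← Matrix.mul_assoc] at hK'
    rw [optionTensor_single_mul_controlledZ, Matrix.mul_assoc, controlledZ_mul_optionTensor_single]
      at hK'
    simp only [optionTensor_mul, Matrix.one_mul, Matrix.mul_one] at hK'
    have h3 := smul_eq_smul_of_optionTensor_eq hK' i j
    rw [← CZCircuit.op_append, ← CZCircuit.op_append] at h3
    have hv' : (Matrix.single i i 1 * v * Matrix.single j j 1 : Matrix _ _ ℂ) i j = v i j := by
      simp
    rw [hv'] at h3
    have h4 := eq_smul_of_smul_eq_smul_star D₁.op_mem_unitaryGroup D₄.op_mem_unitaryGroup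
      (CZCircuit.op_mem_unitaryGroup _) hij h3
    rw [← CZCircuit.op_append, ← CZCircuit.op_append] at h4
    refine ⟨_, _, h4, ?_⟩
    simp only [CZCircuit.czCount_append, czCount_pauliZPow]
    omega

theorem smul_one_mem_unitaryGroup {c : ℂ} (hc : star c * c = 1) :
    (c • 1 : Matrix (Fin 2) (Fin 2) ℂ) ∈ Matrix.unitaryGroup (Fin 2) ℂ := by
  rw [Matrix.mem_unitaryGroup_iff', star_smul, star_one, smul_mul_smul_comm, hc, one_smul, one_mul]

theorem star_mul_self_eq_one_of_smul_unitary {ι : Type} [Fintype ι] [DecidableEq ι] [Nonempty ι]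
    {c : ℂ} {M : Matrix ι ι ℂ} (hM : M ∈ Matrix.unitaryGroup ι ℂ)
    (hcM : c • M ∈ Matrix.unitaryGroup ι ℂ) : star c * c = 1 := by
  rw [Matrix.mem_unitaryGroup_iff', star_smul, smul_mul_smul_comm,
    Matrix.mem_unitaryGroup_iff'.1 hM] at hcM
  obtain ⟨i⟩ := ‹Nonempty ι›
  simpa using congrFun (congrFun hcM i) i

/-- A global phase can be absorbed into a one-qubit gate. -/
theorem exists_circuit_smul [Nonempty Q] (C : CZCircuit Q) {c : ℂ} (hc : star c * c = 1) :
    ∃ D : CZCircuit Q, D.op = c • C.op ∧ D.czCount = C.czCount := by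
  obtain ⟨q⟩ := ‹Nonempty Q›
  refine ⟨.single q ⟨c • 1, smul_one_mem_unitaryGroup hc⟩ :: C, ?_, ?_⟩
  · rw [CZCircuit.op_cons, CZGate.op, onQubit_smul_one, smul_mul_assoc, one_mul]
  · rw [CZCircuit.czCount_cons, CZGate.czCount, zero_add]

theorem mem_unitaryGroup_of_optionTensor {B : QOp Q}
    (h : optionTensor 1 B ∈ Matrix.unitaryGroup (Option Q → Fin 2) ℂ) :
    B ∈ Matrix.unitaryGroup (Q → Fin 2) ℂ := by
  rw [Matrix.mem_unitaryGroup_iff] at h ⊢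
  have hs : star (optionTensor 1 B) = optionTensor 1 (star B) := by
    ext x y
    simp only [Matrix.star_apply, optionTensor_apply, star_mul', Matrix.one_apply]
    simp only [eq_comm (a := y none)]
    split_ifs <;> simp
  rw [hs, optionTensor_mul, one_mul, ← optionTensor_one] at h
  simpa using smul_eq_smul_of_optionTensor_eq h 0 0

/-! ### Ancillae in qubit-minimal optimal circuits. -/

/-- The ancilla `a` is moved to `none`. -/
def separateAncilla (Q : Type) {s : ℕ} (a : Fin (s + 1)) :
    Q ⊕ Fin (s + 1) ≃ Option (Q ⊕ Fin s) where
  toFun := Sum.elim (fun q => some (.inl q)) fun j => (finSuccEquiv' a j).map .inr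
  invFun := fun o => o.elim (.inr a) (Sum.elim .inl fun j => .inr (a.succAbove j))
  left_inv := by
    rintro (q | j)
    · rfl
    · rcases eq_or_ne j a with rfl | h
      · simp
      · obtain ⟨k, rfl⟩ := Fin.exists_succAbove_eq h
        simp
  right_inv := by
    rintro (_ | q | j) <;> simp

theorem relabel_separateAncilla (U : QOp Q) {s : ℕ} (a : Fin (s + 1)) :
    relabel (separateAncilla Q a) (withAncillae U (s + 1)) = optionTensor 1 (withAncillae U s) := by
  ext x y
  rw [relabel_apply, withAncillae_apply, optionTensor_apply, withAncillae_apply, mul_left_comm]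
  congr 1
  rw [Matrix.one_apply, Matrix.one_apply, Matrix.one_apply]
  simp only [funext_iff (β := fun _ : Fin (s + 1) => Fin 2), Fin.forall_iff_succAbove a]
  simp only [separateAncilla, funext_iff, Equiv.coe_fn_mk, Sum.elim_inr]
  simp
  split_ifs <;> simp_all

theorem three_le_czTouching_of_isQubitMinimalCZOptimal [Nonempty Q] {U : QOp Q} {t : ℕ}
    {C : CZCircuit (Q ⊕ Fin t)} (hC : IsQubitMinimalCZOptimal U t C) (a : Fin t) :
    3 ≤ C.czTouching (Sum.inr a) := by
  by_contra! hlt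
  obtain ⟨⟨hop, hcost⟩, hmin⟩ := hC
  rcases t with _ | s
  · exact a.elim0
  have hnone : separateAncilla Q a (Sum.inr a) = none := by simp [separateAncilla]
  have hop' : CZCircuit.op (C.map (CZGate.relabel (separateAncilla Q a))) =
      optionTensor 1 (withAncillae U s) := by
    rw [CZCircuit.op_relabel, hop, relabel_separateAncilla]
  have htouch := CZCircuit.czTouching_relabel (separateAncilla Q a) C (Sum.inr a)
  rw [hnone] at htouch
  obtain ⟨c, D, hB, hcount⟩ := exists_circuit_without_none _ _ (by omega) hop'
  rw [htouch, CZCircuit.czCount_relabel] at hcount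
  have hu : withAncillae U s ∈ Matrix.unitaryGroup _ ℂ :=
    mem_unitaryGroup_of_optionTensor (hop' ▸ CZCircuit.op_mem_unitaryGroup _)
  rw [hB] at hu
  obtain ⟨D', hD', hcount'⟩ := exists_circuit_smul D
    (star_mul_self_eq_one_of_smul_unitary D.op_mem_unitaryGroup hu)
  rw [← hB] at hD'
  have hle : czCostAncilla U ≤ D'.czCount :=
    (iInf_le _ s).trans (czCost_le_czCount D' hD')
  have hle' : C.czCount ≤ D'.czCount := by
    rw [← hcost] at hle
    exact_mod_cast hle
  -- `hcount` and the optimality of `C` force equal CZ counts, so `D'` is optimal with one ancilla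
  -- fewer.
  have hlast : s + 1 ≤ s := hmin s D' ⟨hD', by rw [← hcost]; congr 1; omega⟩
  omega

theorem exists_isQubitMinimalCZOptimal {U : QOp Q} (h : czCostAncilla U ≠ ⊤) :
    ∃ (t : ℕ) (C : CZCircuit (Q ⊕ Fin t)), IsQubitMinimalCZOptimal U t C := by
  classical
  have hex : ∃ (t : ℕ) (C : CZCircuit (Q ⊕ Fin t)), IsCZOptimal U t C := by
    obtain ⟨t, ht⟩ := ciInf_mem fun t => czCost (withAncillae U t)
    change czCost (withAncillae U t) = czCostAncilla U at ht
    obtain ⟨C, hC, hcost⟩ := exists_czCount_eq_czCost (ht ▸ h)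
    exact ⟨t, C, hC, hcost.trans ht⟩
  obtain ⟨C, hC⟩ := Nat.find_spec hex
  exact ⟨_, C, hC, fun s D hD => Nat.find_min' hex ⟨D, hD⟩⟩

/-- Ancillae do not help with operators that need at most three `CZ` gates. -/
theorem czCostAncilla_eq_czCost_of_le_three [Nonempty Q] {U : QOp Q} (h : czCost U ≤ 3) :
    czCostAncilla U = czCost U := by
  refine le_antisymm (czCostAncilla_le_czCost U) ?_
  have htop : czCostAncilla U ≠ ⊤ :=
    ne_top_of_le_ne_top (by decide) ((czCostAncilla_le_czCost U).trans h)
  obtain ⟨t, C, hC⟩ := exists_isQubitMinimalCZOptimal htop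
  rcases t with _ | t
  · rw [← czCost_withAncillae_zero, ← hC.1.2]
    exact czCost_le_czCount C hC.1.1
  -- A remaining ancilla alone accounts for three CZ gates, which is at least `czCost U`.
  · have h3 := (three_le_czTouching_of_isQubitMinimalCZOptimal hC 0).trans
      (C.czTouching_le_czCount _)
    rw [← hC.1.2]
    exact h.trans (by exact_mod_cast h3)

end Register

/-! ### Explicit two-qubit circuits and the magic basis. -/

section TwoQubits

/-- An operator on two qubits, given as a matrix indexed by pairs of bits. -/
def ofPair (M : Matrix (Fin 2 × Fin 2) (Fin 2 × Fin 2) ℂ) : QOp (Fin 2) :=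
  M.submatrix (finTwoArrowEquiv (Fin 2)) (finTwoArrowEquiv (Fin 2))

theorem ofPair_apply (M : Matrix (Fin 2 × Fin 2) (Fin 2 × Fin 2) ℂ) (x y : Fin 2 → Fin 2) :
    ofPair M x y = M (x 0, x 1) (y 0, y 1) := rfl

/-- `M` is computed by a circuit without ancillae that has exactly `k` `CZ` gates. -/
def IsComputable (k : ℕ) (M : Matrix (Fin 2 × Fin 2) (Fin 2 × Fin 2) ℂ) : Prop :=
  ∃ C : CZCircuit (Fin 2), C.op = ofPair M ∧ C.czCount = k

theorem IsComputable.mul {j k : ℕ} {M N : Matrix (Fin 2 × Fin 2) (Fin 2 × Fin 2) ℂ}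
    (hM : IsComputable j M) (hN : IsComputable k N) : IsComputable (j + k) (M * N) := by
  obtain ⟨C, hC, hj⟩ := hM
  obtain ⟨D, hD, hk⟩ := hN
  refine ⟨C ++ D, ?_, by rw [CZCircuit.czCount_append, hj, hk]⟩
  rw [CZCircuit.op_append, hC, hD, ofPair, ofPair, ofPair, Matrix.submatrix_mul_equiv]

theorem IsComputable.kronecker {a b : Matrix (Fin 2) (Fin 2) ℂ}
    (ha : a ∈ Matrix.unitaryGroup (Fin 2) ℂ) (hb : b ∈ Matrix.unitaryGroup (Fin 2) ℂ) :
    IsComputable 0 (a ⊗ₖ b) := by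
  have h₁ : IsComputable 0 (a ⊗ₖ (1 : Matrix (Fin 2) (Fin 2) ℂ)) := by
    refine ⟨[.single 0 ⟨a, ha⟩], ?_, rfl⟩
    ext x y
    simp [CZGate.op, onQubit, ofPair_apply, Matrix.one_apply]
  have h₂ : IsComputable 0 ((1 : Matrix (Fin 2) (Fin 2) ℂ) ⊗ₖ b) := by
    refine ⟨[.single 1 ⟨b, hb⟩], ?_, rfl⟩
    ext x y
    simp [CZGate.op, onQubit, ofPair_apply, Matrix.one_apply]
  have := h₁.mul h₂
  rwa [← Matrix.mul_kronecker_mul, Matrix.mul_one, Matrix.one_mul] at this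

/-- The `CZ` gate as a matrix indexed by pairs of bits. -/
def czPair : Matrix (Fin 2 × Fin 2) (Fin 2 × Fin 2) ℂ :=
  Matrix.diagonal fun p => if p.1 = 1 ∧ p.2 = 1 then -1 else 1

theorem isComputable_czPair : IsComputable 1 czPair := by
  refine ⟨[.cz 0 1 (by decide)], ?_, rfl⟩
  ext x y
  have h : x = y ↔ (x 0, x 1) = (y 0, y 1) := by
    rw [funext_iff, Fin.forall_fin_two, Prod.mk.injEq]
  simp only [CZCircuit.op_cons, CZCircuit.op_nil, mul_one, CZGate.op, controlledZ, ofPair_apply,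
    czPair, Matrix.diagonal_apply, h]

/-- The Hadamard matrix, written with a square root `r` of `1 / 2`. -/
def hadamard (r : ℂ) : Matrix (Fin 2) (Fin 2) ℂ := !![r, r; r, -r]

theorem hadamard_mem_unitaryGroup {r : ℝ} (hr : r * r = 1 / 2) :
    hadamard r ∈ Matrix.unitaryGroup (Fin 2) ℂ := by
  have hr' : (r : ℂ) * r = 1 / 2 := by rw [← Complex.ofReal_mul, hr]; norm_num
  rw [Matrix.mem_unitaryGroup_iff]
  ext i j
  fin_cases i <;> fin_cases j <;>
    simp [hadamard, Matrix.mul_apply, Matrix.star_apply, hr'] <;> norm_num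

/-- The `CNOT` gate with the second qubit as control. -/
def cnotSecond : Matrix (Fin 2 × Fin 2) (Fin 2 × Fin 2) ℂ :=
  Matrix.of fun p q => if p.1 = q.1 + q.2 ∧ p.2 = q.2 then 1 else 0

/-- The `CNOT` gate with the first qubit as control. -/
def cnotFirst : Matrix (Fin 2 × Fin 2) (Fin 2 × Fin 2) ℂ :=
  Matrix.of fun p q => if p.1 = q.1 ∧ p.2 = q.1 + q.2 then 1 else 0

theorem exists_sqrt_half : ∃ r : ℝ, r * r = 1 / 2 :=
  ⟨√(1 / 2), Real.mul_self_sqrt (by norm_num)⟩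

/-- Conjugating CZ by Hadamard gates on the target turns the controlled Z into a controlled X. -/
theorem isComputable_cnotSecond : IsComputable 1 cnotSecond := by
  obtain ⟨r, hr⟩ := exists_sqrt_half
  have hr' : (r : ℂ) * r = 1 / 2 := by rw [← Complex.ofReal_mul, hr]; norm_num
  have hH := IsComputable.kronecker (hadamard_mem_unitaryGroup hr) (one_mem _)
  convert (hH.mul isComputable_czPair).mul hH using 1
  ext ⟨i, j⟩ ⟨k, l⟩
  fin_cases i <;> fin_cases j <;> fin_cases k <;> fin_cases l <;>
    simp [cnotSecond, hadamard, czPair, Matrix.mul_apply, Fintype.sum_prod_type,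
      Matrix.diagonal_apply, hr'] <;> norm_num

theorem isComputable_cnotFirst : IsComputable 1 cnotFirst := by
  obtain ⟨r, hr⟩ := exists_sqrt_half
  have hr' : (r : ℂ) * r = 1 / 2 := by rw [← Complex.ofReal_mul, hr]; norm_num
  have hH := IsComputable.kronecker (one_mem _) (hadamard_mem_unitaryGroup hr)
  convert (hH.mul isComputable_czPair).mul hH using 1
  ext ⟨i, j⟩ ⟨k, l⟩
  fin_cases i <;> fin_cases j <;> fin_cases k <;> fin_cases l <;>
    simp [cnotFirst, hadamard, czPair, Matrix.mul_apply, Fintype.sum_prod_type,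
      Matrix.diagonal_apply, hr'] <;> norm_num

/-- The columns are the vectors of the magic basis, scaled to have norm `√2`. -/
def magic : Matrix (Fin 2 × Fin 2) (Fin 4) ℂ :=
  Matrix.of fun p => (![![![1, 0, 0, Complex.I], ![0, Complex.I, 1, 0]],
    ![![0, Complex.I, -1, 0], ![1, 0, 0, -Complex.I]]] : Fin 2 → Fin 2 → Fin 4 → ℂ) p.1 p.2

theorem magic_conjTranspose_mul : magic.conjTranspose * magic = (2 : ℂ) • 1 := by
  ext i j
  fin_cases i <;> fin_cases j <;>
    simp [magic, Matrix.mul_apply, Fintype.sum_prod_type] <;> norm_num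

theorem magic_mul_conjTranspose : magic * magic.conjTranspose = (2 : ℂ) • 1 := by
  ext ⟨i, j⟩ ⟨k, l⟩
  fin_cases i <;> fin_cases j <;> fin_cases k <;> fin_cases l <;>
    simp [magic, Matrix.mul_apply, Fin.sum_univ_four] <;> norm_num

/-- The real rotation whose angle is the argument of `b`, if `b * b' = 1`. -/
noncomputable def qubitRotation (b b' : ℂ) : Matrix (Fin 2) (Fin 2) ℂ :=
  !![(b + b') / 2, (b' - b) * Complex.I / 2; (b - b') * Complex.I / 2, (b + b') / 2]

/-- The matrix `diag (z, z')`. -/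
def phases (z z' : ℂ) : Matrix (Fin 2) (Fin 2) ℂ := !![z, 0; 0, z']

theorem phases_mem_unitaryGroup {z w : ℂ} (hz : z * star z = 1) (hw : w * star w = 1) :
    phases z w ∈ Matrix.unitaryGroup (Fin 2) ℂ := by
  rw [Matrix.mem_unitaryGroup_iff]
  ext i j
  simp only [Complex.star_def] at hz hw
  fin_cases i <;> fin_cases j <;>
    simp [phases, Matrix.mul_apply, Matrix.star_apply, hz, hw]

theorem qubitRotation_mem_unitaryGroup {b : ℂ} (hb : b * star b = 1) :
    qubitRotation b (star b) ∈ Matrix.unitaryGroup (Fin 2) ℂ := by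
  rw [Matrix.mem_unitaryGroup_iff]
  ext i j
  simp only [Complex.star_def] at hb
  have hI := Complex.I_mul_I
  fin_cases i <;> fin_cases j <;>
    simp [qubitRotation, Matrix.mul_apply, Matrix.star_apply, Complex.conj_ofNat] <;>
    grind

/-- A circuit with three `CZ` gates that is diagonal in the magic basis. -/
theorem circuit_mul_magic (z z' b b' g g' : ℂ) :
    phases 1 (-Complex.I) ⊗ₖ 1 * cnotSecond * phases z z' ⊗ₖ qubitRotation b b' * cnotFirst *
        (1 : Matrix (Fin 2) (Fin 2) ℂ) ⊗ₖ qubitRotation g g' * cnotSecond *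
        (1 : Matrix (Fin 2) (Fin 2) ℂ) ⊗ₖ phases 1 Complex.I * magic =
      magic * Matrix.diagonal ![z * b * g, z' * b' * g, -(z' * b * g'), z * b' * g'] := by
  have h : ∀ {m : Type} (M : Matrix (Fin 2 × Fin 2) m ℂ) (i j : Fin 2) (k : m),
      (cnotSecond * M) (i, j) k = M (i + j, j) k := by
    intro m M i j k
    fin_cases i <;> fin_cases j <;>
      simp [cnotSecond, Matrix.mul_apply, Fintype.sum_prod_type]
  have h' : ∀ {m : Type} (M : Matrix (Fin 2 × Fin 2) m ℂ) (i j : Fin 2) (k : m),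
      (cnotFirst * M) (i, j) k = M (i, i + j) k := by
    intro m M i j k
    fin_cases i <;> fin_cases j <;>
      simp [cnotFirst, Matrix.mul_apply, Fintype.sum_prod_type]
  have hK : ∀ {m : Type} (u v : Matrix (Fin 2) (Fin 2) ℂ) (M : Matrix (Fin 2 × Fin 2) m ℂ)
      (i j : Fin 2) (k : m), (u ⊗ₖ v * M) (i, j) k =
        u i 0 * (v j 0 * M (0, 0) k + v j 1 * M (0, 1) k) +
          u i 1 * (v j 0 * M (1, 0) k + v j 1 * M (1, 1) k) := by
    intro m u v M i j k
    simp [Matrix.mul_apply, Fintype.sum_prod_type]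
    ring
  have hI := Complex.I_mul_I
  -- Associated to the right, the gates act in turn on the columns of `magic`. The first phase gate
  -- and CNOT turn these into multiples of |0⟩ or |1⟩ tensored with (1, ±i), the eigenvectors of all
  -- real rotations. The rotation by `g` then acts by a scalar; `cnotFirst` swaps (1, i) and (1,
  -- -i), up to scalars, when the first bit is 1, so the next gates contribute the other scalars;
  -- the last CNOT and phase gate lead back to the magic basis, with a minus sign on the third
  -- vector.
  simp only [Matrix.mul_assoc]
  ext ⟨i, j⟩ k
  rw [Matrix.mul_diagonal]
  simp only [hK, h, h']
  fin_cases i <;> fin_cases j <;> fin_cases k <;>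
    simp [phases, qubitRotation, magic, Matrix.one_apply] <;> grind

theorem isComputable_magic_diagonal (d : Fin 4 → ℂ) (hd : ∀ k, ‖d k‖ = 1) :
    IsComputable 3 (magic * Matrix.diagonal d * ((1 / 2 : ℂ) • magic.conjTranspose)) := by
  obtain ⟨t₀, h₀⟩ := (Complex.norm_eq_one_iff _).1 (hd 0)
  obtain ⟨t₁, h₁⟩ := (Complex.norm_eq_one_iff _).1 (hd 1)
  -- The circuit puts a minus sign on the third magic vector, so the angle is that of `-d 2`.
  obtain ⟨t₂, h₂⟩ := (Complex.norm_eq_one_iff (-d 2)).1 (by rw [norm_neg, hd])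
  obtain ⟨t₃, h₃⟩ := (Complex.norm_eq_one_iff _).1 (hd 3)
  have hstar : ∀ t : ℝ, star (Complex.exp (t * Complex.I)) = Complex.exp (-(t * Complex.I)) := by
    intro t
    rw [Complex.star_def, ← Complex.exp_conj]
    simp
  have hunit : ∀ t : ℝ, Complex.exp (t * Complex.I) * star (Complex.exp (t * Complex.I)) = 1 := by
    intro t
    rw [hstar, ← Complex.exp_add, add_neg_cancel, Complex.exp_zero]
  -- The angles solve t₀ = f + z + b + g, t₁ = f - z - b + g, t₂ = f - z + b - g, t₃ = f + z - b -
  -- g. The sign matrix has orthogonal columns of squared length 4, hence the division by 4.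
  set f : ℝ := (t₀ + t₁ + t₂ + t₃) / 4 with hf
  set z : ℝ := (t₀ - t₁ - t₂ + t₃) / 4 with hz
  set b : ℝ := (t₀ - t₁ + t₂ - t₃) / 4 with hb
  set g : ℝ := (t₀ + t₁ - t₂ - t₃) / 4 with hg
  have key := circuit_mul_magic (Complex.exp (z * Complex.I)) (star (Complex.exp (z * Complex.I)))
    (Complex.exp (b * Complex.I)) (star (Complex.exp (b * Complex.I)))
    (Complex.exp (g * Complex.I)) (star (Complex.exp (g * Complex.I)))
  have hdiag : Matrix.diagonal d = Complex.exp (f * Complex.I) • Matrix.diagonal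
      ![Complex.exp (z * Complex.I) * Complex.exp (b * Complex.I) * Complex.exp (g * Complex.I),
        star (Complex.exp (z * Complex.I)) * star (Complex.exp (b * Complex.I)) *
          Complex.exp (g * Complex.I),
        -(star (Complex.exp (z * Complex.I)) * Complex.exp (b * Complex.I) *
          star (Complex.exp (g * Complex.I))),
        Complex.exp (z * Complex.I) * star (Complex.exp (b * Complex.I)) *
          star (Complex.exp (g * Complex.I))] := by
    rw [← Matrix.diagonal_smul]
    congr 1
    funext k
    simp only [hstar, ← Complex.exp_add]
    have h₂' : d 2 = -Complex.exp (t₂ * Complex.I) := by rw [h₂, neg_neg]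
    fin_cases k
    · simp [← h₀, ← Complex.exp_add, hf, hz, hb, hg]; ring_nf
    · simp [← h₁, ← Complex.exp_add, hf, hz, hb, hg]; ring_nf
    · simp [h₂', ← Complex.exp_add, hf, hz, hb, hg]; ring_nf
    · simp [← h₃, ← Complex.exp_add, hf, hz, hb, hg]; ring_nf
  rw [hdiag, Matrix.mul_smul magic, ← key, ← Matrix.smul_mul _ _ magic, Matrix.mul_assoc _ magic,
    Matrix.mul_smul magic,
    magic_mul_conjTranspose, smul_smul, one_div, inv_mul_cancel₀ two_ne_zero, one_smul,
    Matrix.mul_one]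
  simp only [← Matrix.smul_mul, ← Matrix.smul_kronecker]
  -- The global phase is absorbed into the one-qubit gate that acts last.
  have hphase : Complex.exp (f * Complex.I) • phases 1 (-Complex.I) =
      phases (Complex.exp (f * Complex.I)) (-(Complex.exp (f * Complex.I) * Complex.I)) := by
    ext i j
    fin_cases i <;> fin_cases j <;> simp [phases]
  rw [hphase]
  have hone := one_mem (Matrix.unitaryGroup (Fin 2) ℂ)
  have hS : phases (Complex.exp (f * Complex.I)) (-(Complex.exp (f * Complex.I) * Complex.I)) ∈
      Matrix.unitaryGroup (Fin 2) ℂ := by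
    refine phases_mem_unitaryGroup (hunit f) ?_
    have := hunit f
    have hI := Complex.I_mul_I
    rw [star_neg, star_mul', Complex.star_def, Complex.conj_I]
    rw [Complex.star_def] at this
    linear_combination this - Complex.exp (f * Complex.I) *
      (starRingEnd ℂ) (Complex.exp (f * Complex.I)) * hI
  have hz' : phases (Complex.exp (z * Complex.I)) (star (Complex.exp (z * Complex.I))) ∈
      Matrix.unitaryGroup (Fin 2) ℂ :=
    phases_mem_unitaryGroup (hunit z) (by rw [star_star, mul_comm]; exact hunit z)
  exact ((((((IsComputable.kronecker hS hone).mul isComputable_cnotSecond).mul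
    (.kronecker hz' (qubitRotation_mem_unitaryGroup (hunit b)))).mul isComputable_cnotFirst).mul
    (.kronecker hone (qubitRotation_mem_unitaryGroup (hunit g)))).mul isComputable_cnotSecond).mul
    (.kronecker hone (phases_mem_unitaryGroup (by simp) (by simp)))

end TwoQubits

/-! ### Real orthogonal diagonalization and the factorization of unitary matrices. -/

section Diagonalization

/-- Commuting real symmetric matrices are simultaneously diagonalized by a real orthogonal
matrix. -/
theorem exists_orthogonal_simultaneous_diagonalization {n : ℕ} {A B : Matrix (Fin n) (Fin n) ℝ}
    (hA : A.IsHermitian) (hB : B.IsHermitian) (hAB : A * B = B * A) :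
    ∃ P ∈ Matrix.orthogonalGroup (Fin n) ℝ, ∃ α β : Fin n → ℝ,
      A * P = P * Matrix.diagonal α ∧ B * P = P * Matrix.diagonal β := by
  classical
  have hA' := Matrix.isSymmetric_toEuclideanLin_iff.2 hA
  have hB' := Matrix.isSymmetric_toEuclideanLin_iff.2 hB
  have hcomm : Commute A.toEuclideanLin B.toEuclideanLin := by
    ext v i
    have := congrFun (congrArg (fun M => M.mulVec v.ofLp) hAB) i
    simpa [Matrix.toLpLin_apply, Matrix.mulVec_mulVec] using this
  -- Joint eigenspaces are indexed by pairs of actual eigenvalues, a finite type, as the subordinate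
  -- orthonormal basis requires.
  have hfam := (LinearMap.IsSymmetric.orthogonalFamily_eigenspace_inf_eigenspace hA' hB').comp
    (f := fun i : Module.End.Eigenvalues B.toEuclideanLin ×
      Module.End.Eigenvalues A.toEuclideanLin => ((i.1 : ℝ), (i.2 : ℝ))) (by
        rintro ⟨i, j⟩ ⟨k, l⟩ h
        rw [Prod.mk.injEq] at h
        exact Prod.ext (Subtype.ext h.1) (Subtype.ext h.2))
  have hint : DirectSum.IsInternal fun i : Module.End.Eigenvalues B.toEuclideanLin ×
      Module.End.Eigenvalues A.toEuclideanLin => Module.End.eigenspace A.toEuclideanLin (i.2 : ℝ) ⊓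
        Module.End.eigenspace B.toEuclideanLin (i.1 : ℝ) := by
    rw [OrthogonalFamily.isInternal_iff hfam, Submodule.orthogonal_eq_bot_iff, eq_top_iff,
      ← LinearMap.IsSymmetric.iSup_iSup_eigenspace_inf_eigenspace_eq_top_of_commute hA' hB' hcomm]
    refine iSup_le fun α => iSup_le fun β => ?_
    -- Real numbers that are not eigenvalues contribute only the zero space to the supremum.
    by_cases hα : Module.End.eigenspace A.toEuclideanLin α = ⊥
    · rw [hα, bot_inf_eq]
      exact bot_le
    by_cases hβ : Module.End.eigenspace B.toEuclideanLin β = ⊥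
    · rw [hβ, inf_bot_eq]
      exact bot_le
    have hα' : Module.End.HasEigenvalue A.toEuclideanLin α := Module.End.hasEigenvalue_iff.2 hα
    have hβ' : Module.End.HasEigenvalue B.toEuclideanLin β := Module.End.hasEigenvalue_iff.2 hβ
    exact le_iSup (fun i : Module.End.Eigenvalues B.toEuclideanLin ×
      Module.End.Eigenvalues A.toEuclideanLin => Module.End.eigenspace A.toEuclideanLin (i.2 : ℝ) ⊓
        Module.End.eigenspace B.toEuclideanLin (i.1 : ℝ)) (⟨β, hβ'⟩, ⟨α, hα'⟩)
  have hn : Module.finrank ℝ (EuclideanSpace ℝ (Fin n)) = n := finrank_euclideanSpace_fin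
  set p := hint.subordinateOrthonormalBasis hn hfam with hp
  set χ := fun k => hint.subordinateOrthonormalBasisIndex hn k hfam with hχ
  have hmem : ∀ k, p k ∈ Module.End.eigenspace A.toEuclideanLin ((χ k).2 : ℝ) ⊓
      Module.End.eigenspace B.toEuclideanLin ((χ k).1 : ℝ) :=
    fun k => hint.subordinateOrthonormalBasis_subordinate hn k hfam
  refine ⟨Matrix.of fun i k => p k i, ?_, fun k => ((χ k).2 : ℝ), fun k => ((χ k).1 : ℝ), ?_, ?_⟩
  · rw [Matrix.mem_orthogonalGroup_iff']
    ext j k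
    have := orthonormal_iff_ite.1 p.orthonormal j k
    rw [Matrix.one_apply, ← this]
    simp [Matrix.mul_apply, PiLp.inner_apply, mul_comm]
  · ext i k
    have := congrArg (fun v : EuclideanSpace ℝ (Fin n) => v i)
      (Module.End.mem_eigenspace_iff.1 (hmem k).1)
    simp only [Matrix.toLpLin_apply, PiLp.smul_apply, Matrix.mulVec, dotProduct, smul_eq_mul] at this
    rw [Matrix.mul_diagonal, Matrix.mul_apply, Matrix.of_apply, mul_comm, ← this]
    rfl
  · ext i k
    have := congrArg (fun v : EuclideanSpace ℝ (Fin n) => v i)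
      (Module.End.mem_eigenspace_iff.1 (hmem k).2)
    simp only [Matrix.toLpLin_apply, PiLp.smul_apply, Matrix.mulVec, dotProduct, smul_eq_mul] at this
    rw [Matrix.mul_diagonal, Matrix.mul_apply, Matrix.of_apply, mul_comm, ← this]
    rfl

/-- The complex matrix with the same entries as a real one. -/
def complexify {m n : Type} (A : Matrix m n ℝ) : Matrix m n ℂ := A.map Complex.ofReal

theorem complexify_mul {l m n : Type} [Fintype m] (A : Matrix l m ℝ) (B : Matrix m n ℝ) :
    complexify (A * B) = complexify A * complexify B :=
  Matrix.map_mul (f := Complex.ofRealHom)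

theorem complexify_one {n : Type} [DecidableEq n] : complexify (1 : Matrix n n ℝ) = 1 :=
  Matrix.map_one _ Complex.ofReal_zero Complex.ofReal_one

theorem complexify_diagonal {n : Type} [DecidableEq n] (α : n → ℝ) :
    complexify (Matrix.diagonal α) = Matrix.diagonal fun k => (α k : ℂ) :=
  Matrix.diagonal_map Complex.ofReal_zero

theorem complexify_conjTranspose {m n : Type} (A : Matrix m n ℝ) :
    (complexify A).conjTranspose = complexify A.transpose := by
  ext i j
  simp [complexify]

theorem complexify_mem_unitaryGroup {n : Type} [Fintype n] [DecidableEq n] {P : Matrix n n ℝ}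
    (hP : P ∈ Matrix.orthogonalGroup n ℝ) : complexify P ∈ Matrix.unitaryGroup n ℂ := by
  rw [Matrix.mem_orthogonalGroup_iff] at hP
  rw [Matrix.mem_unitaryGroup_iff, Matrix.star_eq_conjTranspose, complexify_conjTranspose,
    ← complexify_mul, ← complexify_one]
  exact congrArg complexify hP

theorem complexify_injective {m n : Type} {A B : Matrix m n ℝ}
    (h : complexify A = complexify B) : A = B := by
  ext i j
  simpa [complexify] using congrFun (congrFun h i) j

/-- A unitary matrix that is also complex orthogonal is real. -/
theorem exists_real_of_transpose_mul_self {n : Type} [Fintype n] [DecidableEq n] {K : Matrix n n ℂ}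
    (hK : K ∈ Matrix.unitaryGroup n ℂ) (hKT : K.transpose * K = 1) :
    ∃ O ∈ Matrix.orthogonalGroup n ℝ, complexify O = K := by
  have hT : K.transpose = star K := by
    calc K.transpose = K.transpose * (K * star K) := by
          rw [Matrix.mem_unitaryGroup_iff.1 hK, Matrix.mul_one]
      _ = star K := by rw [← Matrix.mul_assoc, hKT, Matrix.one_mul]
  have hre : complexify (K.map Complex.re) = K := by
    ext i j
    have := congrFun (congrFun hT j) i
    rw [Matrix.transpose_apply, Matrix.star_apply] at this
    exact Complex.conj_eq_iff_re.1 this.symm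
  refine ⟨_, ?_, hre⟩
  rw [Matrix.mem_orthogonalGroup_iff']
  apply complexify_injective
  rw [complexify_mul, ← complexify_conjTranspose, hre, complexify_one]
  exact Matrix.mem_unitaryGroup_iff'.1 hK

/-- A symmetric unitary matrix is diagonalized by a real orthogonal matrix. -/
theorem exists_orthogonal_diagonalization_of_symmetric_unitary {n : ℕ}
    {W : Matrix (Fin n) (Fin n) ℂ} (hW : W ∈ Matrix.unitaryGroup (Fin n) ℂ)
    (hsymm : W.transpose = W) :
    ∃ P ∈ Matrix.orthogonalGroup (Fin n) ℝ, ∃ c : Fin n → ℂ,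
      W * complexify P = complexify P * Matrix.diagonal c := by
  have hdec : W = complexify (W.map Complex.re) + Complex.I • complexify (W.map Complex.im) := by
    ext i j
    simp [complexify, mul_comm Complex.I, Complex.re_add_im]
  have hA : (W.map Complex.re).IsHermitian := by
    rw [Matrix.IsHermitian, Matrix.conjTranspose_eq_transpose_of_trivial, ← Matrix.transpose_map, hsymm]
  have hB : (W.map Complex.im).IsHermitian := by
    rw [Matrix.IsHermitian, Matrix.conjTranspose_eq_transpose_of_trivial, ← Matrix.transpose_map, hsymm]
  set A := W.map Complex.re
  set B := W.map Complex.im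
  have hstar : star W = complexify A - Complex.I • complexify B := by
    conv_lhs => rw [hdec]
    rw [star_add, star_smul, Matrix.star_eq_conjTranspose, Matrix.star_eq_conjTranspose,
      complexify_conjTranspose, complexify_conjTranspose,
      ← Matrix.conjTranspose_eq_transpose_of_trivial,
      ← Matrix.conjTranspose_eq_transpose_of_trivial, hA.eq, hB.eq, Complex.star_def,
      Complex.conj_I, neg_smul, sub_eq_add_neg]
  have hAB : A * B = B * A := by
    -- With W = A + iB and W* = A - iB, comparing W W* with W* W leaves 2i(AB - BA) = 0.
    have h := (Matrix.mem_unitaryGroup_iff.1 hW).trans (Matrix.mem_unitaryGroup_iff'.1 hW).symm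
    rw [hstar] at h
    rw [hdec] at h
    simp only [add_mul, mul_add, mul_sub, sub_mul, smul_mul_assoc, mul_smul_comm, smul_add,
      smul_sub] at h
    have h2 : (2 * Complex.I) • (complexify A * complexify B) =
        (2 * Complex.I) • (complexify B * complexify A) := by
      rw [mul_smul, mul_smul, two_smul, two_smul, ← sub_eq_zero] at *
      rw [← neg_zero, ← h]
      abel
    have h3 := smul_right_injective _ (mul_ne_zero two_ne_zero Complex.I_ne_zero) h2
    rw [← complexify_mul, ← complexify_mul] at h3
    exact complexify_injective h3
  obtain ⟨P, hP, α, β, hα, hβ⟩ := exists_orthogonal_simultaneous_diagonalization hA hB hAB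
  refine ⟨P, hP, fun k => α k + Complex.I * β k, ?_⟩
  rw [hdec, add_mul, smul_mul_assoc, ← complexify_mul, ← complexify_mul, hα, hβ, complexify_mul,
    complexify_mul, complexify_diagonal, complexify_diagonal, ← Matrix.mul_smul, ← mul_add,
    ← Matrix.diagonal_smul, Matrix.diagonal_add]
  rfl

/-- Every unitary matrix is a product of a real orthogonal, a diagonal unitary and a real orthogonal
matrix. -/
theorem exists_orthogonal_diagonal_orthogonal {n : ℕ} {U : Matrix (Fin n) (Fin n) ℂ}
    (hU : U ∈ Matrix.unitaryGroup (Fin n) ℂ) :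
    ∃ K ∈ Matrix.orthogonalGroup (Fin n) ℝ, ∃ P ∈ Matrix.orthogonalGroup (Fin n) ℝ,
      ∃ d : Fin n → ℂ, (∀ k, ‖d k‖ = 1) ∧
        U = complexify K * Matrix.diagonal d * (complexify P).conjTranspose := by
  have hUT : U.transpose ∈ Matrix.unitaryGroup (Fin n) ℂ := by
    rw [Matrix.mem_unitaryGroup_iff]
    have := congrArg Matrix.transpose (Matrix.mem_unitaryGroup_iff'.1 hU)
    rwa [Matrix.transpose_mul, Matrix.transpose_one] at this
  obtain ⟨P, hP, c, hc⟩ := exists_orthogonal_diagonalization_of_symmetric_unitary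
    (mul_mem hUT hU) (by rw [Matrix.transpose_mul, Matrix.transpose_transpose])
  have hPC := complexify_mem_unitaryGroup hP
  have hPT : (complexify P).transpose = star (complexify P) := by
    rw [Matrix.star_eq_conjTranspose, complexify_conjTranspose]
    rfl
  have hdiag : Matrix.diagonal c = star (complexify P) * (U.transpose * U) * complexify P := by
    rw [Matrix.mul_assoc, hc, ← Matrix.mul_assoc, Matrix.mem_unitaryGroup_iff'.1 hPC,
      Matrix.one_mul]
  have hcu : Matrix.diagonal c ∈ Matrix.unitaryGroup (Fin n) ℂ := by
    rw [hdiag]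
    exact mul_mem (mul_mem (Unitary.star_mem hPC) (mul_mem hUT hU)) hPC
  have hcnorm : ∀ k, ‖c k‖ = 1 := by
    intro k
    rw [Matrix.mem_unitaryGroup_iff, Matrix.star_eq_conjTranspose, Matrix.diagonal_conjTranspose,
      Matrix.diagonal_mul_diagonal, ← Matrix.diagonal_one] at hcu
    have := congrFun (Matrix.diagonal_injective hcu) k
    rw [Pi.star_apply, Complex.star_def, Complex.mul_conj'] at this
    have h2 : ‖c k‖ ^ 2 = 1 := by exact_mod_cast this
    exact (pow_eq_one_iff_of_nonneg (norm_nonneg _) two_ne_zero).1 h2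
  -- Any choice of square roots works, since no determinant condition is imposed on `K` or `P`.
  choose d hd using fun k => IsAlgClosed.exists_pow_nat_eq (c k) (n := 2) (by norm_num)
  have hdnorm : ∀ k, ‖d k‖ = 1 := by
    intro k
    have h2 : ‖d k‖ ^ 2 = 1 := by rw [← norm_pow, hd, hcnorm]
    exact (pow_eq_one_iff_of_nonneg (norm_nonneg _) two_ne_zero).1 h2
  have hdstar : ∀ k, star (d k) * d k = 1 := by
    intro k
    rw [Complex.star_def, Complex.conj_mul', hdnorm]
    norm_num
  have hDu : Matrix.diagonal (star d) ∈ Matrix.unitaryGroup (Fin n) ℂ := by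
    rw [Matrix.mem_unitaryGroup_iff, Matrix.star_eq_conjTranspose, Matrix.diagonal_conjTranspose,
      Matrix.diagonal_mul_diagonal, star_star, ← Matrix.diagonal_one]
    congr 1
    funext k
    exact hdstar k
  -- Take K = U P D⁻¹, where D⁻¹ = `diagonal (star d)`. Then KᵀK = D⁻¹ (Pᵀ Uᵀ U P) D⁻¹ = D⁻¹ D² D⁻¹
  -- = 1, so the unitary K is real.
  obtain ⟨K, hK, hKeq⟩ := exists_real_of_transpose_mul_self
    (mul_mem (mul_mem hU hPC) hDu) (by
      rw [Matrix.transpose_mul, Matrix.transpose_mul, hPT, Matrix.diagonal_transpose]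
      calc Matrix.diagonal (star d) * (star (complexify P) * U.transpose) *
            (U * complexify P * Matrix.diagonal (star d))
          = Matrix.diagonal (star d) * (star (complexify P) * (U.transpose * U) * complexify P) *
            Matrix.diagonal (star d) := by simp only [Matrix.mul_assoc]
        _ = 1 := by
          rw [← hdiag, Matrix.diagonal_mul_diagonal, Matrix.diagonal_mul_diagonal,
            ← Matrix.diagonal_one]
          congr 1
          funext k
          rw [← hd, Pi.star_apply]
          linear_combination (star (d k) * d k + 1) * hdstar k)
  refine ⟨K, hK, P, hP, d, hdnorm, ?_⟩
  rw [hKeq, Matrix.mul_assoc _ (Matrix.diagonal (star d)), Matrix.diagonal_mul_diagonal]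
  have h1 : (Matrix.diagonal fun k => star d k * d k) = (1 : Matrix (Fin n) (Fin n) ℂ) := by
    rw [← Matrix.diagonal_one]
    congr 1
    funext k
    exact hdstar k
  rw [h1, Matrix.mul_one, Matrix.mul_assoc, ← Matrix.star_eq_conjTranspose,
    Matrix.mem_unitaryGroup_iff.1 hPC, Matrix.mul_one]

end Diagonalization

/-! ### Isometries of the quaternions. -/

section Quaternion

/-- The quaternion with coordinates `v` as a complex matrix. -/
def quaternionMatrix (v : EuclideanSpace ℝ (Fin 4)) : Matrix (Fin 2) (Fin 2) ℂ :=
  !![v 0 + v 3 * Complex.I, v 2 + v 1 * Complex.I; -v 2 + v 1 * Complex.I, v 0 - v 3 * Complex.I]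

theorem quaternionMatrix_mul_conjTranspose (v : EuclideanSpace ℝ (Fin 4)) :
    quaternionMatrix v * (quaternionMatrix v).conjTranspose = ((‖v‖ ^ 2 : ℝ) : ℂ) • 1 := by
  have hI := Complex.I_mul_I
  rw [EuclideanSpace.norm_sq_eq, Fin.sum_univ_four]
  ext i j
  fin_cases i <;> fin_cases j <;>
    simp [quaternionMatrix, Matrix.mul_apply] <;> grind

/-- Since 2⟨x, v⟩ = x v* + v x*, the reflection x - 2⟨x, v⟩ v / ‖v‖² equals -v x* v / ‖v‖². -/
theorem quaternionMatrix_reflection (v x : EuclideanSpace ℝ (Fin 4)) (hv : v ≠ 0) :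
    quaternionMatrix ((ℝ ∙ v)ᗮ.reflection x) = (((-‖v‖⁻¹ : ℝ) : ℂ) • quaternionMatrix v) *
      (quaternionMatrix x).conjTranspose * (((‖v‖⁻¹ : ℝ) : ℂ) • quaternionMatrix v) := by
  have hI := Complex.I_mul_I
  have hv' : ‖v‖ ≠ 0 := norm_ne_zero_iff.2 hv
  have hn : ‖v‖⁻¹ * ‖v‖⁻¹ * (v 0 ^ 2 + v 1 ^ 2 + v 2 ^ 2 + v 3 ^ 2) = 1 := by
    have := EuclideanSpace.norm_sq_eq v
    simp only [Fin.sum_univ_four, Real.norm_eq_abs, sq_abs] at this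
    rw [← this]
    field_simp
  have hn' : ((‖v‖⁻¹ : ℝ) : ℂ) * ((‖v‖⁻¹ : ℝ) : ℂ) *
      ((v 0 : ℂ) ^ 2 + (v 1 : ℂ) ^ 2 + (v 2 : ℂ) ^ 2 + (v 3 : ℂ) ^ 2) = 1 := by
    exact_mod_cast hn
  have hr : ∀ k, ((ℝ ∙ v)ᗮ.reflection x) k = x k - 2 * (‖v‖⁻¹ * ‖v‖⁻¹ *
      (v 0 * x 0 + v 1 * x 1 + v 2 * x 2 + v 3 * x 3)) * v k := by
    intro k
    rw [Submodule.reflection_orthogonal_apply, Submodule.reflection_singleton_apply]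
    simp only [PiLp.neg_apply, PiLp.sub_apply, PiLp.smul_apply, PiLp.inner_apply,
      Fin.sum_univ_four, RCLike.inner_apply, conj_trivial, smul_eq_mul, nsmul_eq_mul]
    simp
    field_simp
  rw [quaternionMatrix, hr, hr, hr, hr]
  clear hr hn hv' hv
  -- The only fact needed about `s` is `hn'`, so the entries become polynomial identities modulo
  -- that relation and I² = -1.
  generalize ‖v‖⁻¹ = s at *
  ext i j
  fin_cases i <;> fin_cases j <;>
    simp [quaternionMatrix, Matrix.mul_apply, Matrix.vecMul, Matrix.vecHead, Matrix.vecTail] <;>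
    grind

/-- The isometries of the quaternions are `x ↦ a * x * b` and `x ↦ a * star x * b`. -/
theorem exists_quaternionMatrix_isometry
    (φ : EuclideanSpace ℝ (Fin 4) ≃ₗᵢ[ℝ] EuclideanSpace ℝ (Fin 4)) :
    ∃ a ∈ Matrix.unitaryGroup (Fin 2) ℂ, ∃ b ∈ Matrix.unitaryGroup (Fin 2) ℂ,
      (∀ x, quaternionMatrix (φ x) = a * quaternionMatrix x * b) ∨
      (∀ x, quaternionMatrix (φ x) = a * (quaternionMatrix x).conjTranspose * b) := by
  obtain ⟨l, -, rfl⟩ := φ.reflections_generate_dim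
  induction l with
  | nil => exact ⟨1, one_mem _, 1, one_mem _, .inl fun x => by simp⟩
  | cons v l ih =>
    obtain ⟨a, ha, b, hb, h⟩ := ih
    rw [List.map_cons, List.prod_cons]
    -- The list of reflections may contain `v = 0`, whose reflection is the identity.
    by_cases hv : v = 0
    · subst hv
      refine ⟨a, ha, b, hb, ?_⟩
      simpa [Submodule.reflection_mem_subspace_eq_self (Submodule.mem_top (R := ℝ))] using h
    · have hv' : ‖v‖ ≠ 0 := norm_ne_zero_iff.2 hv
      have hu : ∀ s : ℝ, s * s * ‖v‖ ^ 2 = 1 →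
          (s : ℂ) • quaternionMatrix v ∈ Matrix.unitaryGroup (Fin 2) ℂ := by
        intro s hs
        rw [Matrix.mem_unitaryGroup_iff, star_smul, smul_mul_smul_comm,
          Matrix.star_eq_conjTranspose, quaternionMatrix_mul_conjTranspose, smul_smul,
          Complex.star_def, Complex.conj_ofReal]
        rw [show (s : ℂ) * s * ((‖v‖ ^ 2 : ℝ) : ℂ) = 1 by exact_mod_cast hs, one_smul]
      have h₁ := hu (-‖v‖⁻¹) (by field_simp)
      have h₂ := hu ‖v‖⁻¹ (by field_simp)
      refine ⟨_, mul_mem h₁ (Unitary.star_mem hb), _, mul_mem (Unitary.star_mem ha) h₂, ?_⟩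
      -- A reflection sends a x b to a multiple of v (b* x* a*) v, so each one exchanges the two
      -- alternatives.
      refine h.symm.imp (fun h x => ?_) (fun h x => ?_) <;>
      · rw [LinearIsometryEquiv.coe_mul, Function.comp_apply, quaternionMatrix_reflection _ _ hv, h]
        simp only [Matrix.conjTranspose_mul, Matrix.conjTranspose_conjTranspose,
          Matrix.star_eq_conjTranspose, Matrix.mul_assoc]

end Quaternion

/-! ### The canonical decomposition of two-qubit unitaries. -/

section CanonicalDecomposition

/-- The columns of `magic`, reshaped as 2 × 2 matrices, are the quaternion units 1, iX, iY, iZ, so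
real combinations of them are quaternions. -/
theorem magic_mul_complexify_apply (O : Matrix (Fin 4) (Fin 4) ℝ) (i j : Fin 2) (k : Fin 4) :
    (magic * complexify O) (i, j) k = quaternionMatrix (WithLp.toLp 2 fun l => O l k) i j := by
  fin_cases i <;> fin_cases j <;>
    simp [Matrix.mul_apply, Fin.sum_univ_four, magic, complexify, quaternionMatrix] <;> ring

theorem magic_apply (i j : Fin 2) (k : Fin 4) :
    magic (i, j) k = quaternionMatrix (WithLp.toLp 2 fun l => (1 : Matrix _ _ ℝ) l k) i j := by
  rw [← magic_mul_complexify_apply, complexify_one, Matrix.mul_one]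

/-- The signs by which the conjugation of quaternions acts on the standard basis. -/
def conjSign : Fin 4 → ℂ := ![1, -1, -1, -1]

theorem conjTranspose_quaternionMatrix_basis (i j : Fin 2) (k : Fin 4) :
    (quaternionMatrix (WithLp.toLp 2 fun l => (1 : Matrix _ _ ℝ) l k)).conjTranspose i j =
      conjSign k * magic (i, j) k := by
  fin_cases i <;> fin_cases j <;> fin_cases k <;>
    simp [magic, conjSign, quaternionMatrix, Matrix.one_apply]

/-- This reshaping makes left and right multiplication of quaternions into local gates. -/
theorem kronecker_mul_apply {m : Type} (a b : Matrix (Fin 2) (Fin 2) ℂ)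
    (M : Matrix (Fin 2 × Fin 2) m ℂ) (i j : Fin 2) (k : m) :
    (a ⊗ₖ b * M) (i, j) k =
      (a * (Matrix.of fun p q => M (p, q) k) * b.transpose : Matrix _ _ ℂ) i j := by
  simp [Matrix.mul_apply, Fintype.sum_prod_type]
  ring

/-- In the magic basis, real orthogonal matrices are tensor products of one-qubit gates up to
signs. -/
theorem exists_magic_mul_orthogonal {O : Matrix (Fin 4) (Fin 4) ℝ}
    (hO : O ∈ Matrix.orthogonalGroup (Fin 4) ℝ) :
    ∃ a ∈ Matrix.unitaryGroup (Fin 2) ℂ, ∃ b ∈ Matrix.unitaryGroup (Fin 2) ℂ, ∃ s : Fin 4 → ℂ,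
      (∀ k, ‖s k‖ = 1) ∧ magic * complexify O = a ⊗ₖ b * (magic * Matrix.diagonal s) := by
  have hinner : ∀ x y, inner ℝ (O.toEuclideanLin x) (O.toEuclideanLin y) = inner ℝ x y := by
    intro x y
    have h : O.transpose * O = 1 := (Matrix.mem_orthogonalGroup_iff' _ _).1 hO
    simp only [EuclideanSpace.inner_eq_star_dotProduct, Matrix.ofLp_toLpLin, Matrix.toLin'_apply,
      star_trivial, Matrix.dotProduct_mulVec, Matrix.vecMul_mulVec, h, Matrix.vecMul_one]
  let φ : EuclideanSpace ℝ (Fin 4) ≃ₗᵢ[ℝ] EuclideanSpace ℝ (Fin 4) :=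
    (O.toEuclideanLin.isometryOfInner hinner).toLinearIsometryEquiv rfl
  have hφ : ∀ k, φ (WithLp.toLp 2 fun l => (1 : Matrix _ _ ℝ) l k) =
      WithLp.toLp 2 fun l => O l k := by
    intro k
    have : φ (WithLp.toLp 2 fun l => (1 : Matrix _ _ ℝ) l k) =
      O.toEuclideanLin (WithLp.toLp 2 fun l => (1 : Matrix _ _ ℝ) l k) := rfl
    rw [this]
    ext l
    simp [Matrix.toLpLin_apply, Matrix.mulVec, dotProduct, Matrix.one_apply]
  obtain ⟨a, ha, b, hb, h⟩ := exists_quaternionMatrix_isometry φ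
  have hbT : b.transpose ∈ Matrix.unitaryGroup (Fin 2) ℂ := by
    rw [Matrix.mem_unitaryGroup_iff]
    have := congrArg Matrix.transpose (Matrix.mem_unitaryGroup_iff'.1 hb)
    rwa [Matrix.transpose_mul, Matrix.transpose_one] at this
  refine ⟨a, ha, b.transpose, hbT, ?_⟩
  rcases h with h | h
  · refine ⟨fun _ => 1, fun _ => norm_one, ?_⟩
    ext ⟨i, j⟩ k
    rw [magic_mul_complexify_apply, ← hφ, h, kronecker_mul_apply, Matrix.transpose_transpose]
    refine congrArg (fun X : Matrix (Fin 2) (Fin 2) ℂ => (a * X * b) i j) ?_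
    ext p q
    rw [Matrix.of_apply, Matrix.mul_diagonal, mul_one, magic_apply]
  -- Conjugation fixes the unit 1 and negates the three imaginary units, which gives the signs.
  · refine ⟨conjSign, fun k => by fin_cases k <;> simp [conjSign], ?_⟩
    ext ⟨i, j⟩ k
    rw [magic_mul_complexify_apply, ← hφ, h, kronecker_mul_apply, Matrix.transpose_transpose]
    refine congrArg (fun X : Matrix (Fin 2) (Fin 2) ℂ => (a * X * b) i j) ?_
    ext p q
    rw [Matrix.of_apply, Matrix.mul_diagonal, conjTranspose_quaternionMatrix_basis, mul_comm]

/-- Every two-qubit unitary operator is computed by a circuit with three `CZ` gates. -/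
theorem isComputable_three {M : Matrix (Fin 2 × Fin 2) (Fin 2 × Fin 2) ℂ}
    (hM : M ∈ Matrix.unitaryGroup (Fin 2 × Fin 2) ℂ) : IsComputable 3 M := by
  have hU : (1 / 2 : ℂ) • (magic.conjTranspose * M * magic) ∈ Matrix.unitaryGroup (Fin 4) ℂ := by
    rw [Matrix.mem_unitaryGroup_iff, star_smul, Matrix.star_eq_conjTranspose,
      Matrix.conjTranspose_mul, Matrix.conjTranspose_mul, Matrix.conjTranspose_conjTranspose,
      smul_mul_smul_comm]
    calc _ = ((1 / 2 : ℂ) * star (1 / 2 : ℂ)) • (magic.conjTranspose * (M *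
          (magic * magic.conjTranspose) * M.conjTranspose) * magic) := by
          simp only [Matrix.mul_assoc]
      _ = 1 := by
        rw [magic_mul_conjTranspose, Matrix.mul_smul, Matrix.mul_one, Matrix.smul_mul,
          ← Matrix.star_eq_conjTranspose M, Matrix.mem_unitaryGroup_iff.1 hM, Matrix.mul_smul,
          Matrix.mul_one, Matrix.smul_mul, magic_conjTranspose_mul, smul_smul, smul_smul]
        norm_num
  obtain ⟨K, hK, P, hP, d, hd, hdec⟩ := exists_orthogonal_diagonal_orthogonal hU
  obtain ⟨a, ha, b, hb, s, hs, hKmagic⟩ := exists_magic_mul_orthogonal hK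
  obtain ⟨c, hc, e, he, t, ht, hPmagic⟩ := exists_magic_mul_orthogonal hP
  have hM' : M = magic * ((1 / 2 : ℂ) • (magic.conjTranspose * M * magic)) *
      ((1 / 2 : ℂ) • magic.conjTranspose) := by
    calc M = (1 / 2 * (1 / 2) * (2 * 2) : ℂ) • M := by norm_num
      _ = (1 / 2 * (1 / 2) : ℂ) •
          ((magic * magic.conjTranspose) * M * (magic * magic.conjTranspose)) := by
        rw [magic_mul_conjTranspose, Matrix.smul_mul, Matrix.one_mul, Matrix.mul_smul,
          Matrix.mul_one, smul_smul, smul_smul, mul_assoc (1 / 2 * (1 / 2) : ℂ)]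
      _ = _ := by
        simp only [Matrix.mul_smul, Matrix.smul_mul, smul_smul, Matrix.mul_assoc]
  -- The signs from both orthogonal factors merge with `d` into one diagonal, so orthogonal matrices
  -- of determinant -1 do no harm.
  have hfactor : M = a ⊗ₖ b * (magic * Matrix.diagonal (fun k => s k * d k * star (t k)) *
      ((1 / 2 : ℂ) • magic.conjTranspose)) * star c ⊗ₖ star e := by
    rw [hM', hdec]
    have hPmagic' := congrArg Matrix.conjTranspose hPmagic
    simp only [Matrix.conjTranspose_mul, Matrix.diagonal_conjTranspose,
      Matrix.conjTranspose_kronecker] at hPmagic'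
    calc _ = (1 / 2 : ℂ) • ((magic * complexify K) * Matrix.diagonal d *
          ((complexify P).conjTranspose * magic.conjTranspose)) := by
          simp only [Matrix.mul_smul, Matrix.mul_assoc]
      _ = (1 / 2 : ℂ) • (a ⊗ₖ b * (magic * (Matrix.diagonal s * Matrix.diagonal d *
          Matrix.diagonal (star t)) * magic.conjTranspose) * star c ⊗ₖ star e) := by
          rw [hKmagic, hPmagic']
          simp only [Matrix.mul_assoc, Matrix.star_eq_conjTranspose]
      _ = _ := by
          rw [Matrix.diagonal_mul_diagonal, Matrix.diagonal_mul_diagonal]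
          simp only [Matrix.mul_smul, Matrix.smul_mul]
          rfl
  rw [hfactor]
  have hdiag := isComputable_magic_diagonal (fun k => s k * d k * star (t k)) fun k => by
    rw [norm_mul, norm_mul, norm_star, hs, hd, ht, mul_one, mul_one]
  have h := ((IsComputable.kronecker ha hb).mul hdiag).mul
    (.kronecker (Unitary.star_mem hc) (Unitary.star_mem he))
  exact h

theorem czCost_le_three {V : QOp (Fin 2)} (hV : V ∈ Matrix.unitaryGroup (Fin 2 → Fin 2) ℂ) :
    czCost V ≤ 3 := by
  set e := finTwoArrowEquiv (Fin 2)
  have hM : V.submatrix e.symm e.symm ∈ Matrix.unitaryGroup (Fin 2 × Fin 2) ℂ := by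
    rw [Matrix.mem_unitaryGroup_iff, Matrix.star_eq_conjTranspose, Matrix.conjTranspose_submatrix,
      Matrix.submatrix_mul_equiv, ← Matrix.star_eq_conjTranspose, Matrix.mem_unitaryGroup_iff.1 hV,
      Matrix.submatrix_one_equiv]
  obtain ⟨C, hC, hcount⟩ := isComputable_three hM
  have hop : C.op = V := by
    rw [hC, ofPair, Matrix.submatrix_submatrix, Equiv.symm_comp_self, Matrix.submatrix_id_id]
  exact (czCost_le_czCount C hop).trans (by rw [hcount]; rfl)

end CanonicalDecomposition

theorem mainTheorem12 :
    (∀ V : Matrix.unitaryGroup (Fin 2 → Fin 2) ℂ,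
      czCostAncilla (Q := Fin 2) (V : QOp (Fin 2)) = czCost (Q := Fin 2) (V : QOp (Fin 2))
      ∧ czCost (Q := Fin 2) (V : QOp (Fin 2)) ≤ 3)
    ∧ (∀ (n : ℕ), 1 ≤ n → ∀ (A : Matrix.unitaryGroup (Fin n → Fin 2) ℂ) (t : ℕ)
        (C : CZCircuit (Fin n ⊕ Fin t)),
        IsQubitMinimalCZOptimal (Q := Fin n) (A : QOp (Fin n)) t C →
        ∀ a : Fin t, 3 ≤ CZCircuit.czTouching C (Sum.inr a)) := by
  refine ⟨fun V => ?_, fun n hn A t C hC => ?_⟩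
  · have h := czCost_le_three V.2
    exact ⟨czCostAncilla_eq_czCost_of_le_three h, h⟩
  -- A qubit of `A` is needed to carry the global phase once the ancilla is removed.
  · have : Nonempty (Fin n) := ⟨⟨0, hn⟩⟩
    exact three_le_czTouching_of_isQubitMinimalCZOptimal hC
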